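/- Computations are carried out in the standard model of floating-point arithmetic with unit round-off $u>0$: each operation $+,-,\cdot,/,\sqrt{\ }$ returns the exact result times $1+\delta$ for some $|\delta|\le u$. Write $\gamma_k=ku/(1-ku)$, let $\|\cdot\|_2$ be the spectral norm, $M^\dagger$ the Moore–Penrose pseudo-inverse, and $\kappa_2(M)=\|M\|_2\|M^\dagger\|_2$ if $M$ has linearly independent columns, $\kappa_2(M)=\infty$ otherwise. There is an absolute integer constant $c\ge 1$ (the constant of the Householder QR error bound, $\tilde\gamma_{sn}:=\gamma_{csn}$) such that the following holds. Let $m>s>n$, let $A\in\mathbb{R}^{m\times n}$ have linearly independent columns and $S\in\mathbb{R}^{s\times m}$ linearly independent rows, let $A=Q_AR_A$ be an economized QR factorization, and suppose $mu<1$, $csnu<1$. Put $$C_1=\sqrt{sn}\,\gamma_m+\sqrt n\,\tilde\gamma_{sn}\,(1+\sqrt{sn}\,\gamma_m),\qquad k(S)=\|S\|_2\|(SQ_A)^\dagger\|_2,$$ and assume $$\kappa_2(SQ_A)<49,\qquad n^2u<\tfrac1{201},\qquad \tfrac mn+\sqrt n>200,\qquad \kappa_2(A)<\frac1{3C_1k(S)}.$$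 Let $\hat B$ be the product $SA$ computed by the standard algorithm, $\hat R$ the triangular factor computed from $\hat B$ by the Householder QR algorithm, and $\hat Y$ the matrix computed from $A\hat R^{-1}$ by forward substitution applied to the rows. Let $b,\delta b\in\mathbb{R}^m$ and $\Delta\hat Y\in\mathbb{R}^{m\times n}$, suppose that the least squares solver LSQR applied to $\hat Yz=b$ returns $$\hat z=(\hat Y+\Delta\hat Y)^\dagger(b+\delta b),$$ and let $\hat x$ be computed from $\hat Rx=\hat z$ by back substitution. Then there is $\Delta A\in\mathbb{R}^{m\times n}$ such that $\hat x$ solves the least squares problem $\min_x\|(A+\Delta A)x-(b+\delta b)\|_2$ and $$\|\Delta A\|_2<\|S\|_2\|A\|_2\left(6.04\,n\gamma_n\,\|(SQ_A)^\dagger\|_2+2.01\,\|\Delta\hat Y\|_2\right).$$ -/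

import Mathlib

open scoped Matrix Matrix.Norms.L2Operator ENNReal

namespace SketchApply

/-! ### Pseudo-inverse, condition number, QR factorization, least squares

`‖M‖` for a matrix `M` is the spectral norm throughout. -/

/-- `P` is the Moore–Penrose pseudo-inverse of the real matrix `M`. -/
structure IsMoorePenrose {m n : ℕ} (M : Matrix (Fin m) (Fin n) ℝ)
    (P : Matrix (Fin n) (Fin m) ℝ) : Prop where
  mul_mul : M * P * M = M
  mul_mul' : P * M * P = P
  symm_left : (M * P)ᵀ = M * P
  symm_right : (P * M)ᵀ = P * M

theorem exists_isMoorePenrose {m n : ℕ} (M : Matrix (Fin m) (Fin n) ℝ) :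
    ∃ P, IsMoorePenrose M P := by
  have hG : IsSelfAdjoint (Mᵀ * M) := by
    rw [IsSelfAdjoint, Matrix.star_eq_conjTranspose, Matrix.conjTranspose_eq_transpose_of_trivial,
      Matrix.transpose_mul, Matrix.transpose_transpose]
  obtain ⟨g, hgs, hcomm, h1, h2⟩ : ∃ g : Matrix (Fin n) (Fin n) ℝ, gᵀ = g ∧
      g * (Mᵀ * M) = (Mᵀ * M) * g ∧
      (Mᵀ * M) * g * (Mᵀ * M) = Mᵀ * M ∧ g * (Mᵀ * M) * g = g := by
    have hfin : (spectrum ℝ (Mᵀ * M)).Finite := Matrix.finite_real_spectrum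
    have hc : ∀ f : ℝ → ℝ, ContinuousOn f (spectrum ℝ (Mᵀ * M)) := fun f => hfin.continuousOn f
    refine ⟨cfc (fun x : ℝ => x⁻¹) (Mᵀ * M), ?_, ?_, ?_, ?_⟩
    · have := cfc_predicate (R := ℝ) (fun x : ℝ => x⁻¹) (Mᵀ * M)
      rwa [IsSelfAdjoint, Matrix.star_eq_conjTranspose,
        Matrix.conjTranspose_eq_transpose_of_trivial] at this
    · nth_rewrite 2 [← cfc_id' ℝ (Mᵀ * M)]
      nth_rewrite 3 [← cfc_id' ℝ (Mᵀ * M)]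
      exact (cfc_commute_cfc _ _ _).eq
    · nth_rewrite 1 [← cfc_id' ℝ (Mᵀ * M)]
      nth_rewrite 3 [← cfc_id' ℝ (Mᵀ * M)]
      rw [← cfc_mul _ _ _ (hc _) (hc _), ← cfc_mul _ _ _ (hc _) (hc _)]
      conv_rhs => rw [← cfc_id' ℝ (Mᵀ * M)]
      congr 1
      funext x
      exact mul_inv_mul_cancel x
    · nth_rewrite 2 [← cfc_id' ℝ (Mᵀ * M)]
      rw [← cfc_mul _ _ _ (hc _) (hc _), ← cfc_mul _ _ _ (hc _) (hc _)]
      congr 1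
      funext x
      simpa using mul_inv_mul_cancel x⁻¹
  refine ⟨g * Mᵀ, ?_, ?_, ?_, ?_⟩
  · have h0 : (M * g * (Mᵀ * M) - M)ᵀ * (M * g * (Mᵀ * M) - M) = 0 := by
      have e : Mᵀ * (M * g * (Mᵀ * M) - M) = 0 := by
        rw [Matrix.mul_sub, ← Matrix.mul_assoc Mᵀ (M * g), ← Matrix.mul_assoc Mᵀ M g, h1, sub_self]
      have e' : (M * g * (Mᵀ * M) - M)ᵀ = (Mᵀ * M * g - 1) * Mᵀ := by
        simp only [Matrix.transpose_sub, Matrix.transpose_mul, Matrix.transpose_transpose, hgs,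
          Matrix.sub_mul, Matrix.one_mul, Matrix.mul_assoc]
      rw [e', Matrix.mul_assoc, e, Matrix.mul_zero]
    rw [← Matrix.conjTranspose_eq_transpose_of_trivial] at h0
    have := sub_eq_zero.mp (Matrix.conjTranspose_mul_self_eq_zero.mp h0)
    simpa only [Matrix.mul_assoc] using this
  · rw [Matrix.mul_assoc g Mᵀ M, ← Matrix.mul_assoc, h2]
  · simp only [Matrix.transpose_mul, Matrix.transpose_transpose, hgs, Matrix.mul_assoc]
  · rw [Matrix.mul_assoc g, Matrix.transpose_mul, hgs, Matrix.transpose_mul,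
      Matrix.transpose_transpose, hcomm]

/-- The Moore–Penrose pseudo-inverse `M†` (the four conditions have exactly one solution). -/
noncomputable def pinv {m n : ℕ} (M : Matrix (Fin m) (Fin n) ℝ) : Matrix (Fin n) (Fin m) ℝ :=
  (exists_isMoorePenrose M).choose

theorem pinv_spec {m n : ℕ} (M : Matrix (Fin m) (Fin n) ℝ) : IsMoorePenrose M (pinv M) :=
  (exists_isMoorePenrose M).choose_spec

open Classical in
/-- The spectral condition number `κ₂(M) = ‖M‖₂ ‖M†‖₂` of a matrix with linearly independent
columns; it is `∞` when the columns are linearly dependent. -/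
noncomputable def condNum {m n : ℕ} (M : Matrix (Fin m) (Fin n) ℝ) : ℝ≥0∞ :=
  if LinearIndependent ℝ M.col then ENNReal.ofReal (‖M‖ * ‖pinv M‖) else ⊤

/-- `A = Q R` is an economized QR factorization. -/
structure IsEconomyQR {m n : ℕ} (A Q : Matrix (Fin m) (Fin n) ℝ)
    (R : Matrix (Fin n) (Fin n) ℝ) : Prop where
  orthonormal : Qᵀ * Q = 1
  upper : ∀ i j, j < i → R i j = 0
  eq : A = Q * R

/-- `x` is a solution of the least squares problem `min_y ‖M y - b‖₂`. -/
def IsLeastSquaresSolution {m n : ℕ} (M : Matrix (Fin m) (Fin n) ℝ) (b : Fin m → ℝ)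
    (x : Fin n → ℝ) : Prop :=
  ∀ y : Fin n → ℝ, ‖WithLp.toLp 2 (M *ᵥ x - b)‖ ≤ ‖WithLp.toLp 2 (M *ᵥ y - b)‖

/-! ### Floating-point arithmetic with unit round-off `u`

Standard model: the computed value of one operation `+, -, *, /, √` is the exact value times
`1 + δ` with `|δ| ≤ u`. An algorithm is described by the relation between its input and every
output that it can produce when each operation commits such an arbitrary error. -/

/-- `y` is a possible computed value for an operation whose exact result is `x`. -/
def Rounds (u x y : ℝ) : Prop := ∃ δ : ℝ, |δ| ≤ u ∧ y = x * (1 + δ)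

/-- `r` is computed from `c + ∑ aᵢ bᵢ`, adding the products to `c` one after the other. -/
def FlAddDot (u : ℝ) : List (ℝ × ℝ) → ℝ → ℝ → Prop
  | [], c, r => r = c
  | ab :: l, c, r => ∃ p c', Rounds u (ab.1 * ab.2) p ∧ Rounds u (c + p) c' ∧ FlAddDot u l c' r

/-- `r` is computed from the inner product `∑ aᵢ bᵢ` by recursive summation (the first
product is the initial value, so that `k` terms take `k - 1` additions). -/
def FlDot (u : ℝ) : List (ℝ × ℝ) → ℝ → Prop
  | [], r => r = 0
  | ab :: l, r => ∃ p, Rounds u (ab.1 * ab.2) p ∧ FlAddDot u l p r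

/-- `r` is computed from `c - ∑ aᵢ bᵢ`, subtracting the products from `c` one after the other. -/
def FlSubDot (u : ℝ) : List (ℝ × ℝ) → ℝ → ℝ → Prop
  | [], c, r => r = c
  | ab :: l, c, r => ∃ p c', Rounds u (ab.1 * ab.2) p ∧ Rounds u (c - p) c' ∧ FlSubDot u l c' r

/-- `C` is computed from `A * B` by the standard algorithm. -/
def FlMatMul (u : ℝ) {m n p : ℕ} (A : Matrix (Fin m) (Fin n) ℝ) (B : Matrix (Fin n) (Fin p) ℝ)
    (C : Matrix (Fin m) (Fin p) ℝ) : Prop :=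
  ∀ i j, FlDot u (List.ofFn fun k => (A i k, B k j)) (C i j)

/-- `y` is computed from the lower triangular system `Rᵀ y = a` by forward substitution:
`y_j = (a_j - ∑_{k < j} R_{kj} y_k) / R_{jj}`. -/
def FlForwardSub (u : ℝ) {n : ℕ} (R : Matrix (Fin n) (Fin n) ℝ) (a y : Fin n → ℝ) : Prop :=
  ∀ j, ∃ t, FlSubDot u (((List.finRange n).filter (· < j)).map fun k => (R k j, y k)) (a j) t ∧
    Rounds u (t / R j j) (y j)

/-- `x` is computed from the upper triangular system `R x = z` by back substitution:
`x_i = (z_i - ∑_{k > i} R_{ik} x_k) / R_{ii}`. -/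
def FlBackSub (u : ℝ) {n : ℕ} (R : Matrix (Fin n) (Fin n) ℝ) (z x : Fin n → ℝ) : Prop :=
  ∀ i, ∃ t, FlSubDot u (((List.finRange n).filter (i < ·)).map fun k => (R i k, x k)) (z i) t ∧
    Rounds u (t / R i i) (x i)

/-- `Y` is computed from `A R⁻¹` by forward substitution on the systems `Rᵀ yᵢ = aᵢ`, where `aᵢ`
and `yᵢ` are the rows of `A` and `Y`. -/
def FlRightTriSolve (u : ℝ) {m n : ℕ} (R : Matrix (Fin n) (Fin n) ℝ)
    (A Y : Matrix (Fin m) (Fin n) ℝ) : Prop :=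
  ∀ i, FlForwardSub u R (A i) (Y i)

/-- `σ` is computed from `sign(x₀) ‖x‖₂`, with `sign(0) = 1`. -/
def FlSignedNorm (u : ℝ) {k : ℕ} (x : Fin (k + 1) → ℝ) (σ : ℝ) : Prop :=
  ∃ d t, FlDot u (List.ofFn fun i => (x i, x i)) d ∧ Rounds u (Real.sqrt d) t ∧
    σ = if 0 ≤ x 0 then t else -t

/-- `v` and `β` are computed from the Householder vector `v = x + σ e₀` and the scalar
`β = 1 / (σ v₀)`, which define the reflector `I - β v vᵀ` mapping `x` to `-σ e₀`. -/
def FlHouseholderVector (u : ℝ) {k : ℕ} (x : Fin (k + 1) → ℝ) (σ : ℝ) (v : Fin (k + 1) → ℝ)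
    (β : ℝ) : Prop :=
  Rounds u (x 0 + σ) (v 0) ∧ (∀ i : Fin k, v i.succ = x i.succ) ∧
    ∃ p, Rounds u (σ * v 0) p ∧ Rounds u (1 / p) β

/-- `y` is computed from `(I - β v vᵀ) b = b - (β (vᵀ b)) v`. -/
def FlApplyReflector (u : ℝ) {k : ℕ} (v : Fin k → ℝ) (β : ℝ) (b y : Fin k → ℝ) : Prop :=
  ∃ τ w, FlDot u (List.ofFn fun i => (v i, b i)) τ ∧ Rounds u (β * τ) w ∧
    ∀ i, ∃ p, Rounds u (w * v i) p ∧ Rounds u (b i - p) (y i)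

/-- `R` is the upper triangular factor computed by the Householder QR algorithm from a matrix `B`
with at least as many rows as columns. One step reduces the first column to `-σ e₀`, applies the
reflector to the other columns (the step is skipped when the column is zero), reads off the first
row of `R`, and the algorithm continues with the trailing submatrix. -/
def FlHouseholderQR (u : ℝ) : {s n : ℕ} → Matrix (Fin s) (Fin n) ℝ →
    Matrix (Fin n) (Fin n) ℝ → Prop
  | _, 0, _, _ => True
  | 0, _ + 1, _, _ => False
  | s + 1, n + 1, B, R =>
    ∃ (σ : ℝ) (C : Matrix (Fin (s + 1)) (Fin n) ℝ),
      FlSignedNorm u (fun i => B i 0) σ ∧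
      (σ = 0 → ∀ i j, C i j = B i j.succ) ∧
      (σ ≠ 0 → ∃ v β, FlHouseholderVector u (fun i => B i 0) σ v β ∧
        ∀ j : Fin n, FlApplyReflector u v β (fun i => B i j.succ) (fun i => C i j)) ∧
      R 0 0 = -σ ∧ (∀ j : Fin n, R 0 j.succ = C 0 j) ∧ (∀ i : Fin n, R i.succ 0 = 0) ∧
      FlHouseholderQR u (C.submatrix Fin.succ id) (R.submatrix Fin.succ Fin.succ)

/-! ### Constants -/

/-- `γ_k = k u / (1 - k u)`; `γ̃_{sn}` is `γ_{c s n}`. -/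
noncomputable def gam (u : ℝ) (k : ℕ) : ℝ := k * u / (1 - k * u)

/-- `C₁ = √(sn) γ_m + √n γ̃_{sn} (1 + √(sn) γ_m)`. -/
noncomputable def C₁ (c : ℕ) (u : ℝ) (m s n : ℕ) : ℝ :=
  Real.sqrt (s * n) * gam u m +
    Real.sqrt n * gam u (c * s * n) * (1 + Real.sqrt (s * n) * gam u m)

/-- `k(S) = ‖S‖₂ ‖(S Q_A)†‖₂`. -/
noncomputable def kS {m s n : ℕ} (S : Matrix (Fin s) (Fin m) ℝ) (QA : Matrix (Fin m) (Fin n) ℝ) :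
    ℝ :=
  ‖S‖ * ‖pinv (S * QA)‖

end SketchApply

open SketchApply

/-!
Rounding errors are counted by powers of `1 + u`. Each Householder step is backward stable in every
column, so `R̂` is an exact triangular factor of `SA + E` with `‖E‖ ≤ C₁ ‖S‖ ‖A‖`. Since
`3 C₁ k(S) κ₂(A) < 1`, the perturbation `E` can be absorbed in the bound
`‖Ax‖ ≤ (3/2) ‖(SQ_A)†‖ ‖R̂x‖`: hence `R̂` is nonsingular, and `Ŷ ≈ A R̂⁻¹` satisfies
`‖Ŷ‖ ≤ 1.51 ‖(SQ_A)†‖`. Back substitution solves `(R̂ + ΔR) x̂ = ẑ` exactly for some small `ΔR`, and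
`ẑ` solves the least squares problem of `Ŷ + ΔŶ`. Therefore `x̂` solves the one of
`A + ΔA = (Ŷ + ΔŶ)(R̂ + ΔR)`, and expanding the product bounds `ΔA`.
-/

namespace SketchApply

local notation "‖" v "‖₂" => ‖WithLp.toLp 2 v‖

section Norms

variable {m n : Type*} [Fintype m] [Fintype n]

theorem norm_toLp_sq (v : n → ℝ) : ‖v‖₂ ^ 2 = ∑ i, v i ^ 2 :=
  EuclideanSpace.real_norm_sq_eq _

theorem norm_toLp_sq_eq_dotProduct (v : n → ℝ) : ‖v‖₂ ^ 2 = v ⬝ᵥ v := by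
  rw [norm_toLp_sq]
  simp only [dotProduct, pow_two]

theorem norm_toLp_mono {v w : n → ℝ} (h : ∀ i, |v i| ≤ |w i|) : ‖v‖₂ ≤ ‖w‖₂ := by
  refine le_of_sq_le_sq ?_ (norm_nonneg _)
  rw [norm_toLp_sq, norm_toLp_sq]
  exact Finset.sum_le_sum fun i _ => sq_le_sq.mpr (h i)

theorem norm_toLp_abs (v : n → ℝ) : ‖fun i => |v i|‖₂ = ‖v‖₂ :=
  le_antisymm (norm_toLp_mono fun _ => (abs_abs _).le) (norm_toLp_mono fun _ => (abs_abs _).ge)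

theorem sum_abs_mul_sq_le (v w : n → ℝ) :
    (∑ i, |v i * w i|) ^ 2 ≤ (∑ i, v i ^ 2) * ∑ i, w i ^ 2 := by
  simpa only [abs_mul, sq_abs] using
    Finset.sum_mul_sq_le_sq_mul_sq Finset.univ (fun i => |v i|) (fun i => |w i|)

theorem sum_abs_mul_le_norm_mul_norm (v w : n → ℝ) : ∑ i, |v i * w i| ≤ ‖v‖₂ * ‖w‖₂ := by
  refine le_of_sq_le_sq ?_ (by positivity)
  rw [mul_pow, norm_toLp_sq, norm_toLp_sq]
  exact sum_abs_mul_sq_le v w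

variable [DecidableEq n]

theorem norm_mulVec_le (M : Matrix m n ℝ) (x : n → ℝ) : ‖M *ᵥ x‖₂ ≤ ‖M‖ * ‖x‖₂ :=
  Matrix.l2_opNorm_mulVec M (WithLp.toLp 2 x)

theorem norm_mulVec_of_transpose_mul_self_eq_one {Q : Matrix m n ℝ} (h : Qᵀ * Q = 1) (x : n → ℝ) :
    ‖Q *ᵥ x‖₂ = ‖x‖₂ := by
  rw [← sq_eq_sq₀ (norm_nonneg _) (norm_nonneg _), norm_toLp_sq_eq_dotProduct,
    norm_toLp_sq_eq_dotProduct, Matrix.dotProduct_mulVec, ← Matrix.vecMul_transpose,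
    Matrix.vecMul_vecMul, h, Matrix.vecMul_one]

theorem norm_le_of_norm_mulVec_le {M : Matrix m n ℝ} {c : ℝ} (hc : 0 ≤ c)
    (h : ∀ x, ‖M *ᵥ x‖₂ ≤ c * ‖x‖₂) : ‖M‖ ≤ c := by
  rw [Matrix.l2_opNorm_def]
  exact ContinuousLinearMap.opNorm_le_bound _ hc fun x => h x.ofLp

theorem norm_transpose [DecidableEq m] (M : Matrix m n ℝ) : ‖Mᵀ‖ = ‖M‖ := by
  rw [← Matrix.conjTranspose_eq_transpose_of_trivial, Matrix.l2_opNorm_conjTranspose]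

theorem norm_col_le (M : Matrix m n ℝ) (j : n) : ‖M.col j‖₂ ≤ ‖M‖ := by
  simpa using norm_mulVec_le M (Pi.single j 1)

end Norms

section Frobenius

variable {l m n : Type*} [Fintype l] [Fintype m] [Fintype n]

/-- The Frobenius norm. Mathlib's `Matrix.frobeniusNormedAddCommGroup` is not used because `‖M‖`
denotes the spectral norm here. -/
noncomputable def frobNorm (M : Matrix m n ℝ) : ℝ := √(∑ i, ∑ j, M i j ^ 2)

theorem frobNorm_nonneg (M : Matrix m n ℝ) : 0 ≤ frobNorm M := Real.sqrt_nonneg _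

theorem frobNorm_sq (M : Matrix m n ℝ) : frobNorm M ^ 2 = ∑ i, ∑ j, M i j ^ 2 :=
  Real.sq_sqrt (by positivity)

theorem frobNorm_transpose (M : Matrix m n ℝ) : frobNorm Mᵀ = frobNorm M :=
  congrArg Real.sqrt Finset.sum_comm

theorem frobNorm_sq_eq_sum_col (M : Matrix m n ℝ) : frobNorm M ^ 2 = ∑ j, ‖M.col j‖₂ ^ 2 := by
  simp only [norm_toLp_sq, Matrix.col_apply, frobNorm_sq]
  exact Finset.sum_comm

theorem frobNorm_le_of_abs_le_sum {F : Matrix m n ℝ} {X : Matrix m l ℝ} {Z : Matrix l n ℝ} {g : ℝ}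
    (hg : 0 ≤ g) (h : ∀ i j, |F i j| ≤ g * ∑ k, |X i k * Z k j|) :
    frobNorm F ≤ g * (frobNorm X * frobNorm Z) := by
  refine le_of_sq_le_sq ?_ (by unfold frobNorm; positivity)
  calc frobNorm F ^ 2 = ∑ i, ∑ j, |F i j| ^ 2 := by simp only [frobNorm_sq, sq_abs]
    _ ≤ ∑ i, ∑ j, g ^ 2 * ((∑ k, X i k ^ 2) * ∑ k, Z k j ^ 2) := by
        gcongr with i _ j
        grw [h i j, mul_pow, sum_abs_mul_sq_le (X i) fun k => Z k j]
    _ = (g * (frobNorm X * frobNorm Z)) ^ 2 := by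
        rw [mul_pow, mul_pow, ← frobNorm_transpose Z, frobNorm_sq, frobNorm_sq, Finset.sum_mul_sum,
          Finset.mul_sum]
        simp only [Finset.mul_sum, Matrix.transpose_apply]

variable [DecidableEq n]

theorem norm_le_frobNorm (M : Matrix m n ℝ) : ‖M‖ ≤ frobNorm M := by
  refine norm_le_of_norm_mulVec_le (frobNorm_nonneg M) fun x => ?_
  refine le_of_sq_le_sq ?_ (mul_nonneg (frobNorm_nonneg M) (norm_nonneg _))
  rw [mul_pow, frobNorm_sq, norm_toLp_sq, norm_toLp_sq, Finset.sum_mul]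
  exact Finset.sum_le_sum fun i _ => Finset.sum_mul_sq_le_sq_mul_sq Finset.univ (M i) x

theorem frobNorm_le_sqrt_card_mul_norm (M : Matrix m n ℝ) :
    frobNorm M ≤ √(Fintype.card n) * ‖M‖ := by
  refine le_of_sq_le_sq ?_ (by positivity)
  rw [frobNorm_sq_eq_sum_col, mul_pow, Real.sq_sqrt (Nat.cast_nonneg _)]
  calc ∑ j, ‖M.col j‖₂ ^ 2 ≤ ∑ _j : n, ‖M‖ ^ 2 := by
        gcongr with j
        exact norm_col_le M j
    _ = Fintype.card n * ‖M‖ ^ 2 := by simp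

theorem frobNorm_le_sqrt_card_rows_mul_norm (M : Matrix m n ℝ) :
    frobNorm M ≤ √(Fintype.card m) * ‖M‖ := by
  classical
  rw [← frobNorm_transpose, ← norm_transpose]
  exact frobNorm_le_sqrt_card_mul_norm Mᵀ

theorem norm_le_of_norm_col_le {F B : Matrix m n ℝ} {g : ℝ} (hg : 0 ≤ g)
    (h : ∀ j, ‖F.col j‖₂ ≤ g * ‖B.col j‖₂) : ‖F‖ ≤ g * (√(Fintype.card n) * ‖B‖) := by
  have hF : frobNorm F ≤ g * frobNorm B := by
    refine le_of_sq_le_sq ?_ (mul_nonneg hg (frobNorm_nonneg B))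
    rw [mul_pow, frobNorm_sq_eq_sum_col, frobNorm_sq_eq_sum_col, Finset.mul_sum]
    gcongr with j
    rw [← mul_pow]
    gcongr
    exact h j
  grw [norm_le_frobNorm, hF, frobNorm_le_sqrt_card_mul_norm]

end Frobenius

section LeastSquares

variable {m n : ℕ} {M : Matrix (Fin m) (Fin n) ℝ}

theorem pinv_mul_self (h : LinearIndependent ℝ M.col) : pinv M * M = 1 := by
  have hinj : Function.Injective M.mulVec := Matrix.mulVec_injective_iff.mpr h
  refine Matrix.ext_of_mulVec_single fun j => hinj ?_
  rw [Matrix.mulVec_mulVec, ← Matrix.mul_assoc, (pinv_spec M).mul_mul, Matrix.one_mulVec]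

theorem norm_le_norm_pinv_mul (h : LinearIndependent ℝ M.col) (x : Fin n → ℝ) :
    ‖x‖₂ ≤ ‖pinv M‖ * ‖M *ᵥ x‖₂ := by
  have := norm_mulVec_le (pinv M) (M *ᵥ x)
  rwa [Matrix.mulVec_mulVec, pinv_mul_self h, Matrix.one_mulVec] at this

theorem one_le_norm_mul_norm_pinv [NeZero n] (h : LinearIndependent ℝ M.col) :
    1 ≤ ‖M‖ * ‖pinv M‖ := by
  calc (1 : ℝ) = ‖pinv M * M‖ := by rw [pinv_mul_self h, norm_one]
    _ ≤ ‖M‖ * ‖pinv M‖ := (Matrix.l2_opNorm_mul _ _).trans_eq (mul_comm _ _)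

theorem linearIndependent_of_condNum_lt {c : ℝ≥0∞} (h : condNum M < c) :
    LinearIndependent ℝ M.col := by
  by_contra hM
  simp [condNum, hM] at h

theorem mul_norm_mul_norm_pinv_lt_one_of_condNum_lt {c : ℝ} (hc : 0 < c)
    (h : condNum M < ENNReal.ofReal (1 / c)) : c * (‖M‖ * ‖pinv M‖) < 1 := by
  rw [condNum, if_pos (linearIndependent_of_condNum_lt h),
    ENNReal.ofReal_lt_ofReal_iff_of_nonneg (by positivity), lt_div_iff₀ hc] at h
  rwa [mul_comm]

theorem le_of_linearIndependent_col (h : LinearIndependent ℝ M.col) : n ≤ m := by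
  simpa using h.fintype_card_le_finrank

theorem IsEconomyQR.norm_mulVec {A Q : Matrix (Fin m) (Fin n) ℝ} {R : Matrix (Fin n) (Fin n) ℝ}
    (h : IsEconomyQR A Q R) (x : Fin n → ℝ) : ‖A *ᵥ x‖₂ = ‖R *ᵥ x‖₂ := by
  rw [h.eq, ← Matrix.mulVec_mulVec, norm_mulVec_of_transpose_mul_self_eq_one h.orthonormal]

theorem transpose_mulVec_pinv_residual (M : Matrix (Fin m) (Fin n) ℝ) (b : Fin m → ℝ) :
    Mᵀ *ᵥ (M *ᵥ (pinv M *ᵥ b) - b) = 0 := by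
  have h : Mᵀ * (M * pinv M) = Mᵀ := by
    rw [← (pinv_spec M).symm_left, ← Matrix.transpose_mul, (pinv_spec M).mul_mul]
  rw [Matrix.mulVec_sub, Matrix.mulVec_mulVec, Matrix.mulVec_mulVec, Matrix.mul_assoc, h, sub_self]

theorem isLeastSquaresSolution_pinv (M : Matrix (Fin m) (Fin n) ℝ) (b : Fin m → ℝ) :
    IsLeastSquaresSolution M b (pinv M *ᵥ b) := by
  intro y
  set x := pinv M *ᵥ b
  have orthogonal : (M *ᵥ (y - x)) ⬝ᵥ (M *ᵥ x - b) = 0 := by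
    rw [dotProduct_comm, Matrix.dotProduct_mulVec, ← Matrix.mulVec_transpose,
      transpose_mulVec_pinv_residual, zero_dotProduct]
  have residual_eq : M *ᵥ y - b = M *ᵥ (y - x) + (M *ᵥ x - b) := by
    rw [Matrix.mulVec_sub]; abel
  refine le_of_sq_le_sq ?_ (norm_nonneg _)
  have pythagoras : ‖M *ᵥ y - b‖₂ ^ 2 = ‖M *ᵥ (y - x)‖₂ ^ 2 + ‖M *ᵥ x - b‖₂ ^ 2 := by
    simp only [norm_toLp_sq_eq_dotProduct, residual_eq, add_dotProduct, dotProduct_add, orthogonal,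
      dotProduct_comm (M *ᵥ x - b)]
    ring
  exact pythagoras.symm ▸ le_add_of_nonneg_left (sq_nonneg _)

theorem IsLeastSquaresSolution.of_mulVec {N : Matrix (Fin n) (Fin n) ℝ} {b : Fin m → ℝ}
    {x : Fin n → ℝ} (h : IsLeastSquaresSolution M b (N *ᵥ x)) :
    IsLeastSquaresSolution (M * N) b x := by
  intro y
  simpa only [Matrix.mulVec_mulVec] using h (N *ᵥ y)

end LeastSquares

section ErrorCalculus

/-- `y` approximates `x` up to the growth factor `g` at the scale `k`: `k` bounds the modulus of
`x`, and `g` is a product of factors `1 + u` or `(1 - u)⁻¹`, one per rounding, such as Stewart's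
error counter `⟨j⟩`. Growth factors multiply when approximations are composed or multiplied, and
scales follow the operations on the exact values. -/
structure IsApprox (g k x y : ℝ) : Prop where
  abs_le_scale : |x| ≤ k
  error_le : |y - x| ≤ (g - 1) * k

variable {u g h k k' x x' y y' z : ℝ}

namespace IsApprox

theorem refl (hx : |x| ≤ k) : IsApprox 1 k x x := ⟨hx, by simp⟩

theorem scale_nonneg (hxy : IsApprox g k x y) : 0 ≤ k := (abs_nonneg x).trans hxy.abs_le_scale

theorem abs_approx_le (hxy : IsApprox g k x y) : |y| ≤ g * k := by
  linarith [hxy.abs_le_scale, hxy.error_le, abs_sub_abs_le_abs_sub y x]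

theorem mono (hxy : IsApprox g k x y) (hgh : g ≤ h) : IsApprox h k x y :=
  ⟨hxy.abs_le_scale, hxy.error_le.trans (by have := hxy.scale_nonneg; gcongr)⟩

theorem mono_scale (hg : 1 ≤ g) (hxy : IsApprox g k x y) (hk : k ≤ k') : IsApprox g k' x y :=
  ⟨hxy.abs_le_scale.trans hk, hxy.error_le.trans (by gcongr)⟩

theorem trans (hxy : IsApprox g k x y) (hyz : IsApprox h (g * k) y z) : IsApprox (g * h) k x z :=
  ⟨hxy.abs_le_scale, by linarith [abs_sub_le z y x, hxy.error_le, hyz.error_le]⟩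

theorem add (hxy : IsApprox g k x y) (hxy' : IsApprox g k' x' y') :
    IsApprox g (k + k') (x + x') (y + y') := by
  refine ⟨(abs_add_le _ _).trans (add_le_add hxy.abs_le_scale hxy'.abs_le_scale), ?_⟩
  rw [add_sub_add_comm]
  linarith [abs_add_le (y - x) (y' - x'), hxy.error_le, hxy'.error_le]

theorem neg (hxy : IsApprox g k x y) : IsApprox g k (-x) (-y) :=
  ⟨(abs_neg x).trans_le hxy.abs_le_scale, by
    rw [← neg_sub', abs_neg]; exact hxy.error_le⟩

theorem sub (hxy : IsApprox g k x y) (hxy' : IsApprox g k' x' y') :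
    IsApprox g (k + k') (x - x') (y - y') := by
  simpa only [sub_eq_add_neg] using hxy.add hxy'.neg

theorem sum {ι : Type*} {s : Finset ι} {k x y : ι → ℝ}
    (hxy : ∀ i ∈ s, IsApprox g (k i) (x i) (y i)) :
    IsApprox g (∑ i ∈ s, k i) (∑ i ∈ s, x i) (∑ i ∈ s, y i) := by
  refine ⟨(Finset.abs_sum_le_sum_abs _ _).trans
    (Finset.sum_le_sum fun i hi => (hxy i hi).abs_le_scale), ?_⟩
  rw [← Finset.sum_sub_distrib, Finset.mul_sum]
  exact (Finset.abs_sum_le_sum_abs _ _).trans (Finset.sum_le_sum fun i hi => (hxy i hi).error_le)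

theorem mul (hxy : IsApprox g k x y) (hxy' : IsApprox h k' x' y') :
    IsApprox (g * h) (k * k') (x * x') (y * y') := by
  have := hxy.scale_nonneg
  refine ⟨by rw [abs_mul]; gcongr <;> exact abs_le_scale ‹_›, ?_⟩
  calc |y * y' - x * x'| = |(y - x) * y' + x * (y' - x')| := by ring_nf
    _ ≤ |y - x| * |y'| + |x| * |y' - x'| := by
        simpa only [abs_mul] using abs_add_le ((y - x) * y') (x * (y' - x'))
    _ ≤ (g - 1) * k * (h * k') + k * ((h - 1) * k') := by
        gcongr
        exacts [(abs_nonneg _).trans hxy.error_le, hxy.error_le, hxy'.abs_approx_le,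
          hxy.abs_le_scale, hxy'.error_le]
    _ = (g * h - 1) * (k * k') := by ring

theorem sqrt (hx : 0 ≤ x) (hxy : IsApprox g (x ^ 2) (x ^ 2) y) : IsApprox g x x √y := by
  refine ⟨(abs_of_nonneg hx).le, ?_⟩
  have error_mul_le : |√y - x| * x ≤ |y - x ^ 2| := by
    rcases le_total 0 y with hy | hy
    · calc |√y - x| * x ≤ |√y - x| * |√y + x| := by
            gcongr
            exact le_abs.mpr (.inl (le_add_of_nonneg_left (Real.sqrt_nonneg y)))
        _ = |y - x ^ 2| := by rw [← abs_mul, mul_comm, ← sq_sub_sq, Real.sq_sqrt hy]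
    · rw [Real.sqrt_eq_zero_of_nonpos hy, zero_sub, abs_neg, abs_of_nonneg hx, ← sq]
      exact le_abs.mpr (.inr (by linarith))
  rcases hx.eq_or_lt with rfl | hx
  · have hy : y = 0 := by simpa using hxy.error_le
    simp [hy]
  · refine le_of_mul_le_mul_right ?_ hx
    linarith [hxy.error_le]

theorem inv (hx : 0 < x) (hg : g ≤ 3 / 2) (hxy : IsApprox g x x y) :
    IsApprox (g ^ 2) x⁻¹ x⁻¹ y⁻¹ := by
  have hg1 : 0 ≤ g - 1 := nonneg_of_mul_nonneg_left ((abs_nonneg _).trans hxy.error_le) hx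
  have hy : (2 - g) * x ≤ y := by linarith [neg_le_of_abs_le hxy.error_le]
  have hg2 : 0 < 2 - g := by linarith
  have hy0 : 0 < y := (by positivity : 0 < (2 - g) * x).trans_le hy
  refine ⟨(abs_of_pos (inv_pos.mpr hx)).le, ?_⟩
  calc |y⁻¹ - x⁻¹| = |y - x| / (y * x) := by
        rw [inv_sub_inv hy0.ne' hx.ne', abs_div, abs_sub_comm, abs_of_pos (mul_pos hy0 hx)]
    _ ≤ (g - 1) * x / ((2 - g) * x * x) := by
        gcongr
        exact hxy.error_le
    _ = (g - 1) / (2 - g) * x⁻¹ := by field_simp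
    _ ≤ (g ^ 2 - 1) * x⁻¹ := by
        gcongr
        rw [div_le_iff₀ hg2]
        have : 0 ≤ (g + 1) * (2 - g) - 1 := by nlinarith
        linarith [mul_nonneg hg1 this]

end IsApprox

theorem Rounds.isApprox (hxy : Rounds u x y) (hx : |x| ≤ k) : IsApprox (1 + u) k x y := by
  obtain ⟨δ, hδ, rfl⟩ := hxy
  refine ⟨hx, ?_⟩
  calc |x * (1 + δ) - x| = |δ| * |x| := by rw [← abs_mul]; ring_nf
    _ ≤ (1 + u - 1) * k := by
        have := (abs_nonneg δ).trans hδ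
        rw [add_sub_cancel_left]
        gcongr

theorem Rounds.isApprox_symm (hu : u < 1) (hxy : Rounds u x y) (hy : |y| ≤ k) :
    IsApprox (1 - u)⁻¹ k y x := by
  obtain ⟨δ, hδ, hyx⟩ := hxy
  have hδ' : 1 - u ≤ 1 + δ := by linarith [neg_le_of_abs_le hδ]
  have hu' : 0 < 1 - u := by linarith
  have error_eq : x - y = -δ / (1 + δ) * y := by
    rw [hyx]
    field_simp [(hu'.trans_le hδ').ne']
    ring
  refine ⟨hy, ?_⟩
  calc |x - y| = |δ| / (1 + δ) * |y| := by
        rw [error_eq, abs_mul, abs_div, abs_neg, abs_of_pos (hu'.trans_le hδ')]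
    _ ≤ u / (1 - u) * k := by
        have := (abs_nonneg δ).trans hδ
        gcongr
    _ = ((1 - u)⁻¹ - 1) * k := by field_simp; ring

theorem Rounds.mul_left (a : ℝ) (hxy : Rounds u x y) : Rounds u (a * x) (a * y) := by
  obtain ⟨δ, hδ, rfl⟩ := hxy
  exact ⟨δ, hδ, (mul_assoc _ _ _).symm⟩

theorem IsApprox.rounds (hxy : IsApprox g k x y) (hyz : Rounds u y z) :
    IsApprox (g * (1 + u)) k x z :=
  hxy.trans (hyz.isApprox hxy.abs_approx_le)

theorem IsApprox.rounds_symm (hu : u < 1) (hxy : IsApprox g k x y) (hzy : Rounds u z y) :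
    IsApprox (g * (1 - u)⁻¹) k x z :=
  hxy.trans (hzy.isApprox_symm hu hxy.abs_approx_le)

theorem one_add_le_inv_one_sub (hu : u < 1) : 1 + u ≤ (1 - u)⁻¹ := by
  rw [← one_div, le_div_iff₀ (by linarith)]
  nlinarith [sq_nonneg u]

theorem three_mul_sub_one_le_pow_three (hg : 1 ≤ g) : 3 * (g - 1) ≤ g ^ 3 - 1 := by
  have bernoulli := one_add_mul_sub_le_pow (by linarith : -1 ≤ g) 3
  push_cast at bernoulli
  linarith

end ErrorCalculus

section Gam

variable {u : ℝ} {k : ℕ}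

theorem one_add_gam (hk : k * u < 1) : 1 + gam u k = (1 - k * u)⁻¹ := by
  have : 1 - (k : ℝ) * u ≠ 0 := by linarith
  rw [gam]
  field_simp
  ring

theorem gam_nonneg (hu : 0 ≤ u) (hk : k * u < 1) : 0 ≤ gam u k :=
  div_nonneg (by positivity) (by linarith)

theorem one_add_pow_le_one_add_gam (hu : 0 ≤ u) (hk : k * u < 1) :
    (1 + u) ^ k ≤ 1 + gam u k := by
  rw [one_add_gam hk]
  calc (1 + u) ^ k ≤ Real.exp u ^ k := by
        gcongr
        linarith [Real.add_one_le_exp u]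
    _ = (Real.exp (-(k * u)))⁻¹ := by rw [← Real.exp_neg, neg_neg, Real.exp_nat_mul]
    _ ≤ (1 - k * u)⁻¹ := by
        exact inv_anti₀ (by linarith) (Real.one_sub_le_exp_neg _)

theorem one_add_pow_le_three_halves (hu : 0 ≤ u) (hk : 3 * k * u ≤ 1) : (1 + u) ^ k ≤ 3 / 2 := by
  calc (1 + u) ^ k ≤ (1 - k * u)⁻¹ :=
        (one_add_pow_le_one_add_gam hu (by linarith)).trans_eq (one_add_gam (by linarith))
    _ ≤ (1 - 1 / 3)⁻¹ := inv_anti₀ (by norm_num) (by linarith)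
    _ = 3 / 2 := by norm_num

theorem inv_one_sub_pow_le_one_add_gam (hu : u < 1) (hk : k * u < 1) :
    (1 - u)⁻¹ ^ k ≤ 1 + gam u k := by
  rw [one_add_gam hk, inv_pow]
  have bernoulli := one_add_mul_le_pow (a := -u) (by linarith) k
  refine inv_anti₀ (by linarith) ?_
  linarith [show (1 + -u) ^ k = (1 - u) ^ k by rw [sub_eq_add_neg]]

end Gam

section InnerProducts

variable {u : ℝ}

theorem FlAddDot.isApprox (hu : 0 ≤ u) {l : List (ℝ × ℝ)} {c r : ℝ} (h : FlAddDot u l c r)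
    {j : ℕ} {k x : ℝ} (hc : IsApprox ((1 + u) ^ (j + 1)) k x c) :
    IsApprox ((1 + u) ^ (j + 1 + l.length)) (k + (l.map fun ab => |ab.1 * ab.2|).sum)
      (x + (l.map fun ab => ab.1 * ab.2).sum) r := by
  induction l generalizing c j k x with
  | nil =>
    rw [show r = c from h]
    simpa using hc
  | cons ab l ih =>
    obtain ⟨p, c', hp, hc', h⟩ := h
    have product : IsApprox ((1 + u) ^ (j + 1)) |ab.1 * ab.2| (ab.1 * ab.2) p :=
      (hp.isApprox le_rfl).mono (le_self_pow₀ (by linarith) j.succ_ne_zero)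
    have sum := ih h (j := j + 1) ((hc.add product).rounds hc')
    simpa only [List.map_cons, List.sum_cons, List.length_cons, ← add_assoc,
      add_right_comm _ l.length 1] using sum

theorem FlDot.isApprox (hu : 0 ≤ u) {l : List (ℝ × ℝ)} {r : ℝ} (h : FlDot u l r) :
    IsApprox ((1 + u) ^ l.length) (l.map fun ab => |ab.1 * ab.2|).sum
      (l.map fun ab => ab.1 * ab.2).sum r := by
  cases l with
  | nil =>
    rw [show r = 0 from h]
    simpa using IsApprox.refl (x := 0) (k := 0) (by simp)
  | cons ab l =>
    obtain ⟨p, hp, h⟩ := h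
    have := h.isApprox hu (j := 0) ((hp.isApprox le_rfl).mono (by simp))
    simpa only [List.map_cons, List.sum_cons, List.length_cons, zero_add, add_comm 1] using this

theorem FlDot.isApprox_dotProduct (hu : 0 ≤ u) {n : ℕ} {a b : Fin n → ℝ} {r : ℝ}
    (h : FlDot u (List.ofFn fun i => (a i, b i)) r) :
    IsApprox ((1 + u) ^ n) (∑ i, |a i * b i|) (a ⬝ᵥ b) r := by
  simpa only [List.map_ofFn, List.sum_ofFn, List.length_ofFn, Function.comp_def, dotProduct]
    using h.isApprox hu

theorem FlMatMul.norm_sub_le {m n p : ℕ} (hu : 0 ≤ u) (hn : n * u < 1)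
    {A : Matrix (Fin m) (Fin n) ℝ} {B : Matrix (Fin n) (Fin p) ℝ} {C : Matrix (Fin m) (Fin p) ℝ}
    (h : FlMatMul u A B C) : ‖C - A * B‖ ≤ √(m * p) * gam u n * (‖A‖ * ‖B‖) := by
  have hγ := gam_nonneg hu hn
  have entrywise (i j) : |(C - A * B) i j| ≤ gam u n * ∑ k, |A i k * B k j| := by
    have := (((h i j).isApprox_dotProduct hu).mono (one_add_pow_le_one_add_gam hu hn)).error_le
    rwa [add_sub_cancel_left] at this
  calc ‖C - A * B‖ ≤ gam u n * (frobNorm A * frobNorm B) :=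
        (norm_le_frobNorm _).trans (frobNorm_le_of_abs_le_sum hγ entrywise)
    _ ≤ gam u n * ((√m * ‖A‖) * (√p * ‖B‖)) := by
        have := frobNorm_nonneg B
        gcongr
        · simpa using frobNorm_le_sqrt_card_rows_mul_norm A
        · simpa using frobNorm_le_sqrt_card_mul_norm B
    _ = √(m * p) * gam u n * (‖A‖ * ‖B‖) := by rw [Real.sqrt_mul (Nat.cast_nonneg m)]; ring

end InnerProducts

section TriangularSystems

variable {u : ℝ} {n : ℕ}

theorem FlSubDot.isApprox (hu : 0 ≤ u) (hu1 : u < 1) {l : List (ℝ × ℝ)} {c t : ℝ}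
    (h : FlSubDot u l c t) {j : ℕ} {k x : ℝ} (ht : IsApprox ((1 - u)⁻¹ ^ j) k x t) :
    IsApprox ((1 - u)⁻¹ ^ (j + l.length)) (k + (l.map fun ab => |ab.1 * ab.2|).sum)
      (x + (l.map fun ab => ab.1 * ab.2).sum) c := by
  induction l generalizing c with
  | nil =>
    rw [← show t = c from h]
    simpa using ht
  | cons ab l ih =>
    obtain ⟨p, c', hp, hc', h⟩ := h
    have hw : 1 + u ≤ (1 - u)⁻¹ := one_add_le_inv_one_sub hu1
    have difference := (ih h).rounds_symm hu1 hc'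
    rw [← pow_succ] at difference
    have product : IsApprox ((1 - u)⁻¹ ^ (j + l.length + 1)) |ab.1 * ab.2| (ab.1 * ab.2) p :=
      (hp.isApprox le_rfl).mono (hw.trans (le_self_pow₀ (by linarith) (Nat.succ_ne_zero _)))
    convert difference.add product using 1
    · rw [List.length_cons, add_assoc]
    · rw [List.map_cons, List.sum_cons]; ring
    · rw [List.map_cons, List.sum_cons]; ring
    · ring

theorem sum_map_filter_finRange (p : Fin n → Prop) [DecidablePred p] (f : Fin n → ℝ) :
    (((List.finRange n).filter (p ·)).map f).sum = ∑ j with p j, f j := by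
  rw [← List.sum_toFinset _ ((List.nodup_finRange n).filter _), List.toFinset_filter,
    List.toFinset_finRange]
  simp

theorem length_filter_finRange_lt {p : Fin n → Prop} [DecidablePred p] {j : Fin n} (hj : ¬ p j) :
    ((List.finRange n).filter (p ·)).length < n := by
  simpa using List.length_filter_lt_length_iff_exists.mpr
    ⟨j, List.mem_finRange j, by simpa using hj⟩

theorem sum_eq_add_sum_filter {p : Fin n → Prop} [DecidablePred p] {k : Fin n} (hk : ¬ p k)
    {f : Fin n → ℝ} (hf : ∀ j, ¬ p j → j ≠ k → f j = 0) : ∑ j, f j = f k + ∑ j with p j, f j := by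
  rw [← Finset.sum_filter_add_sum_filter_not Finset.univ p, add_comm,
    Finset.sum_eq_single_of_mem k (by simpa using hk) fun j hj => hf j (by simpa using hj)]

/-- In a triangular system, `p` selects the unknowns computed before the `k`-th one. -/
theorem FlSubDot.abs_sub_dotProduct_le (hu : 0 ≤ u) (hu1 : u < 1) (hn : n * u < 1)
    {p : Fin n → Prop} [DecidablePred p] {k : Fin n} (hk : ¬ p k) {r y : Fin n → ℝ} {c t : ℝ}
    (hr : ∀ j, ¬ p j → j ≠ k → r j = 0) (hrk : r k ≠ 0)
    (h : FlSubDot u (((List.finRange n).filter (p ·)).map fun j => (r j, y j)) c t)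
    (hy : Rounds u (t / r k) (y k)) : |c - r ⬝ᵥ y| ≤ gam u n * ∑ j, |r j * y j| := by
  have pivot : IsApprox ((1 - u)⁻¹ ^ 1) |r k * y k| (r k * y k) t := by
    have := hy.mul_left (r k)
    rw [mul_div_cancel₀ _ hrk] at this
    simpa using this.isApprox_symm hu1 le_rfl
  have growth_le : (1 - u)⁻¹ ^ (1 + ((List.finRange n).filter (p ·)).length) ≤ 1 + gam u n := by
    refine le_trans ?_ (inv_one_sub_pow_le_one_add_gam hu1 hn)
    gcongr
    · linarith [one_add_le_inv_one_sub hu1]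
    · have := length_filter_finRange_lt hk
      omega
  have row := h.isApprox hu hu1 pivot
  simp only [List.map_map, Function.comp_def, List.length_map, sum_map_filter_finRange] at row
  have split_sum (f : Fin n → ℝ) (hf : ∀ j, r j = 0 → f j = 0) :
      ∑ j, f j = f k + ∑ j with p j, f j :=
    sum_eq_add_sum_filter hk fun j hj hjk => hf j (hr j hj hjk)
  rw [dotProduct, split_sum (fun j => r j * y j) fun j hj => by simp [hj],
    split_sum (fun j => |r j * y j|) fun j hj => by simp [hj]]
  simpa only [add_sub_cancel_left] using (row.mono growth_le).error_le

variable {R : Matrix (Fin n) (Fin n) ℝ}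

theorem FlForwardSub.abs_sub_vecMul_le (hu : 0 ≤ u) (hu1 : u < 1) (hn : n * u < 1)
    (hR : ∀ i j, j < i → R i j = 0) (hdiag : ∀ i, R i i ≠ 0) {a y : Fin n → ℝ}
    (h : FlForwardSub u R a y) (j : Fin n) :
    |(a - y ᵥ* R) j| ≤ gam u n * ∑ k, |y k * R k j| := by
  obtain ⟨t, ht, hy⟩ := h j
  have := ht.abs_sub_dotProduct_le hu hu1 hn (p := (· < j)) (r := fun k => R k j) (lt_irrefl j)
    (fun k hk hkj => hR k j (lt_of_le_of_ne (not_lt.mp hk) hkj.symm)) (hdiag j) hy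
  simpa only [Pi.sub_apply, Matrix.vecMul, dotProduct_comm y, mul_comm (y _)] using this

theorem FlBackSub.abs_sub_mulVec_le (hu : 0 ≤ u) (hu1 : u < 1) (hn : n * u < 1)
    (hR : ∀ i j, j < i → R i j = 0) (hdiag : ∀ i, R i i ≠ 0) {z x : Fin n → ℝ}
    (h : FlBackSub u R z x) (i : Fin n) :
    |(z - R *ᵥ x) i| ≤ gam u n * ∑ k, |R i k * x k| := by
  obtain ⟨t, ht, hx⟩ := h i
  exact ht.abs_sub_dotProduct_le hu hu1 hn (p := (i < ·)) (lt_irrefl i)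
    (fun k hk hki => hR i k (lt_of_le_of_ne (not_lt.mp hk) hki)) (hdiag i) hx

theorem FlRightTriSolve.norm_sub_mul_le (hu : 0 ≤ u) (hu1 : u < 1) (hn : n * u < 1)
    (hR : ∀ i j, j < i → R i j = 0) (hdiag : ∀ i, R i i ≠ 0) {m : ℕ}
    {A Y : Matrix (Fin m) (Fin n) ℝ} (h : FlRightTriSolve u R A Y) :
    ‖A - Y * R‖ ≤ n * gam u n * (‖Y‖ * ‖R‖) := by
  have hγ := gam_nonneg hu hn
  calc ‖A - Y * R‖ ≤ gam u n * (frobNorm Y * frobNorm R) :=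
        (norm_le_frobNorm _).trans (frobNorm_le_of_abs_le_sum hγ fun i j =>
          (h i).abs_sub_vecMul_le hu hu1 hn hR hdiag j)
    _ ≤ gam u n * ((√n * ‖Y‖) * (√n * ‖R‖)) := by
        have := frobNorm_nonneg R
        gcongr
        · simpa using frobNorm_le_sqrt_card_mul_norm Y
        · simpa using frobNorm_le_sqrt_card_mul_norm R
    _ = √n * √n * gam u n * (‖Y‖ * ‖R‖) := by ring
    _ = n * gam u n * (‖Y‖ * ‖R‖) := by rw [Real.mul_self_sqrt (Nat.cast_nonneg n)]

/-- Oettli–Prager: the residual in row `i` is spread over the entries of that row in proportion to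
`|M i k * x k|`. -/
theorem exists_perturbation_of_abs_residual_le {ι κ : Type*} [Fintype κ] {M : Matrix ι κ ℝ}
    {x : κ → ℝ} {z : ι → ℝ} {ω : ℝ} (hω : 0 ≤ ω)
    (h : ∀ i, |(z - M *ᵥ x) i| ≤ ω * ∑ k, |M i k * x k|) :
    ∃ ΔM : Matrix ι κ ℝ, (∀ i k, |ΔM i k| ≤ ω * |M i k|) ∧ (M + ΔM) *ᵥ x = z := by
  set total : ι → ℝ := fun i => ∑ k, |M i k * x k| with htotal
  have total_nonneg (i) : 0 ≤ total i := by positivity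
  refine ⟨Matrix.of fun i k => (z - M *ᵥ x) i / total i * (|M i k| * SignType.sign (x k)),
    fun i k => ?_, funext fun i => ?_⟩
  · rw [Matrix.of_apply, abs_mul, abs_div, abs_of_nonneg (total_nonneg i), abs_mul, abs_abs]
    gcongr
    · exact div_le_of_le_mul₀ (total_nonneg i) hω (h i)
    · refine mul_le_of_le_one_right (abs_nonneg _) ?_
      cases SignType.sign (x k) <;> simp
  · have residual_eq : (z - M *ᵥ x) i / total i * total i = (z - M *ᵥ x) i :=
      div_mul_cancel_of_imp fun h0 => by
        have := h i
        rwa [show ∑ k, |M i k * x k| = 0 from h0, mul_zero, abs_nonpos_iff] at this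
    have spread : ∑ k, (z - M *ᵥ x) i / total i * (|M i k| * SignType.sign (x k)) * x k
        = (z - M *ᵥ x) i / total i * total i := by
      simp only [htotal, Finset.mul_sum, abs_mul, mul_assoc, sign_mul_self]
    rw [Matrix.add_mulVec]
    exact add_eq_of_eq_sub' (spread.trans residual_eq)

theorem FlBackSub.exists_perturbation (hu : 0 ≤ u) (hu1 : u < 1) (hn : n * u < 1)
    (hR : ∀ i j, j < i → R i j = 0) (hdiag : ∀ i, R i i ≠ 0) {z x : Fin n → ℝ}
    (h : FlBackSub u R z x) :
    ∃ ΔR : Matrix (Fin n) (Fin n) ℝ, ‖ΔR‖ ≤ √n * gam u n * ‖R‖ ∧ (R + ΔR) *ᵥ x = z := by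
  have hγ := gam_nonneg hu hn
  obtain ⟨ΔR, hΔR, hx⟩ :=
    exists_perturbation_of_abs_residual_le hγ (h.abs_sub_mulVec_le hu hu1 hn hR hdiag)
  refine ⟨ΔR, ?_, hx⟩
  have column (j) : ‖ΔR.col j‖₂ ≤ gam u n * ‖R.col j‖₂ := by
    have := norm_toLp_mono (v := ΔR.col j) (w := gam u n • R.col j) fun i => by
      simpa [abs_mul, abs_of_nonneg hγ] using hΔR i j
    simpa [norm_smul, abs_of_nonneg hγ] using this
  calc ‖ΔR‖ ≤ gam u n * (√n * ‖R‖) := by simpa using norm_le_of_norm_col_le hγ column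
    _ = √n * gam u n * ‖R‖ := by ring

end TriangularSystems

section Reflectors

theorem norm_abs_add_smul_abs_le {n : Type*} [Fintype n] {β : ℝ} {v : n → ℝ}
    (hβ : 0 ≤ β) (h : β * (v ⬝ᵥ v) = 2) (b : n → ℝ) :
    ‖fun i => |b i| + β * (∑ j, |v j * b j|) * |v i|‖₂ ≤ 3 * ‖b‖₂ := by
  set c := β * ∑ j, |v j * b j| with hc
  have hc0 : 0 ≤ c := by positivity
  calc ‖fun i => |b i| + c * |v i|‖₂
      = ‖WithLp.toLp 2 (fun i => |b i|) + c • WithLp.toLp 2 fun i => |v i|‖ := rfl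
    _ ≤ ‖b‖₂ + c * ‖v‖₂ := by
        refine (norm_add_le _ _).trans_eq ?_
        rw [norm_smul, norm_toLp_abs, norm_toLp_abs, Real.norm_of_nonneg hc0]
    _ ≤ ‖b‖₂ + β * (‖v‖₂ * ‖b‖₂) * ‖v‖₂ := by
        rw [hc]
        gcongr
        exact sum_abs_mul_le_norm_mul_norm v b
    _ = 3 * ‖b‖₂ := by
        rw [← norm_toLp_sq_eq_dotProduct] at h
        linear_combination ‖b‖₂ * h

variable {n : Type*} [DecidableEq n] {β : ℝ} {v : n → ℝ}

/-- The matrix `I - β v vᵀ`, an orthogonal reflection when `β (vᵀ v) = 2`. -/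
def reflector (β : ℝ) (v : n → ℝ) : Matrix n n ℝ := 1 - β • Matrix.vecMulVec v v

theorem reflector_transpose (β : ℝ) (v : n → ℝ) : (reflector β v)ᵀ = reflector β v := by
  rw [reflector, Matrix.transpose_sub, Matrix.transpose_one, Matrix.transpose_smul,
    Matrix.transpose_vecMulVec]

variable [Fintype n]

theorem reflector_mulVec (β : ℝ) (v b : n → ℝ) :
    reflector β v *ᵥ b = b - (β * (v ⬝ᵥ b)) • v := by
  rw [reflector, Matrix.sub_mulVec, Matrix.one_mulVec, Matrix.smul_mulVec, Matrix.vecMulVec_mulVec,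
    op_smul_eq_smul, smul_smul]

theorem reflector_mul_self (h : β * (v ⬝ᵥ v) = 2) : reflector β v * reflector β v = 1 := by
  refine Matrix.ext_of_mulVec_single fun j => ?_
  rw [← Matrix.mulVec_mulVec, Matrix.one_mulVec]
  ext i
  simp only [reflector_mulVec, dotProduct_sub, dotProduct_smul, smul_eq_mul, Pi.sub_apply,
    Pi.smul_apply]
  linear_combination (β * (v ⬝ᵥ Pi.single j 1) * v i) * h

theorem reflector_transpose_mul_self (h : β * (v ⬝ᵥ v) = 2) :
    (reflector β v)ᵀ * reflector β v = 1 := by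
  rw [reflector_transpose, reflector_mul_self h]

theorem norm_reflector_mulVec_sub (h : β * (v ⬝ᵥ v) = 2) (y b : n → ℝ) :
    ‖reflector β v *ᵥ y - b‖₂ = ‖y - reflector β v *ᵥ b‖₂ := by
  rw [← norm_mulVec_of_transpose_mul_self_eq_one (reflector_transpose_mul_self h) (y - _),
    Matrix.mulVec_sub, Matrix.mulVec_mulVec b, reflector_mul_self h, Matrix.one_mulVec]

end Reflectors

section HouseholderVector

variable {k : ℕ}

/-- The number `sign(x₀) ‖x‖₂` with `sign(0) = 1`, computed by `FlSignedNorm`. -/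
noncomputable def signedNorm (x : Fin (k + 1) → ℝ) : ℝ := if 0 ≤ x 0 then ‖x‖₂ else -‖x‖₂

/-- The Householder vector `x + sign(x₀) ‖x‖₂ e₀`, computed by `FlHouseholderVector`. -/
noncomputable def householderVec (x : Fin (k + 1) → ℝ) : Fin (k + 1) → ℝ :=
  x + Pi.single 0 (signedNorm x)

variable (x : Fin (k + 1) → ℝ)

theorem abs_signedNorm : |signedNorm x| = ‖x‖₂ := by
  unfold signedNorm
  split_ifs <;> simp

theorem signedNorm_sq : signedNorm x ^ 2 = x ⬝ᵥ x := by
  rw [← sq_abs, abs_signedNorm, norm_toLp_sq_eq_dotProduct]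

theorem householderVec_zero : householderVec x 0 = x 0 + signedNorm x := by
  simp [householderVec]

theorem householderVec_succ (i : Fin k) : householderVec x i.succ = x i.succ := by
  simp [householderVec]

theorem abs_householderVec_zero : |householderVec x 0| = |x 0| + ‖x‖₂ := by
  rw [householderVec_zero, ← abs_signedNorm, abs_add_eq_add_abs_iff]
  unfold signedNorm
  split_ifs with hx <;> simp [hx, le_of_not_ge]

theorem signedNorm_mul_householderVec_zero :
    signedNorm x * householderVec x 0 = ‖x‖₂ * |householderVec x 0| := by
  rw [← abs_signedNorm, ← abs_mul, eq_comm, abs_eq_self, householderVec_zero]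
  unfold signedNorm
  split_ifs with hx
  · positivity
  · exact mul_nonneg_of_nonpos_of_nonpos (by simp) (by linarith [norm_nonneg (WithLp.toLp 2 x)])

theorem householderVec_dotProduct_self :
    householderVec x ⬝ᵥ householderVec x = 2 * (signedNorm x * householderVec x 0) := by
  rw [householderVec_zero]
  simp only [householderVec, dotProduct_add, add_dotProduct, dotProduct_single, single_dotProduct,
    Pi.add_apply, Pi.single_eq_same]
  linear_combination -signedNorm_sq x

theorem householderVec_dotProduct : householderVec x ⬝ᵥ x = signedNorm x * householderVec x 0 := by
  rw [householderVec_zero]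
  simp only [householderVec, add_dotProduct, single_dotProduct]
  linear_combination -signedNorm_sq x

variable {x}

theorem signedNorm_mul_householderVec_zero_pos (hx : 0 < ‖x‖₂) :
    0 < signedNorm x * householderVec x 0 := by
  rw [signedNorm_mul_householderVec_zero, abs_householderVec_zero]
  positivity

theorem inv_mul_householderVec_dotProduct_self (hx : 0 < ‖x‖₂) :
    (signedNorm x * householderVec x 0)⁻¹ * (householderVec x ⬝ᵥ householderVec x) = 2 := by
  rw [householderVec_dotProduct_self, mul_left_comm,
    inv_mul_cancel₀ (signedNorm_mul_householderVec_zero_pos hx).ne', mul_one]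

theorem reflector_householderVec_mulVec (hx : 0 < ‖x‖₂) :
    reflector (signedNorm x * householderVec x 0)⁻¹ (householderVec x) *ᵥ x =
      Pi.single 0 (-signedNorm x) := by
  rw [reflector_mulVec, householderVec_dotProduct,
    inv_mul_cancel₀ (signedNorm_mul_householderVec_zero_pos hx).ne', one_smul, householderVec,
    Pi.single_neg]
  abel

variable {u σ : ℝ}

theorem FlSignedNorm.isApprox (hu : 0 ≤ u) (h : FlSignedNorm u x σ) :
    IsApprox ((1 + u) ^ (k + 2)) ‖x‖₂ (signedNorm x) σ := by
  obtain ⟨d, t, hd, ht, rfl⟩ := h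
  have sum_sq : IsApprox ((1 + u) ^ (k + 1)) (‖x‖₂ ^ 2) (‖x‖₂ ^ 2) d := by
    have := hd.isApprox_dotProduct hu
    rwa [← norm_toLp_sq_eq_dotProduct, show ∑ i, |x i * x i| = ‖x‖₂ ^ 2 by
      simp only [norm_toLp_sq, ← sq, abs_sq]] at this
  have norm : IsApprox ((1 + u) ^ (k + 2)) ‖x‖₂ ‖x‖₂ t :=
    (sum_sq.sqrt (norm_nonneg _)).rounds ht
  unfold signedNorm
  split_ifs
  exacts [norm, norm.neg]

variable {v : Fin (k + 1) → ℝ} {β : ℝ}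

theorem FlHouseholderVector.isApprox_vector (hu : 0 ≤ u) (hσ : FlSignedNorm u x σ)
    (h : FlHouseholderVector u x σ v β) (i : Fin (k + 1)) :
    IsApprox ((1 + u) ^ (k + 3)) |householderVec x i| (householderVec x i) (v i) := by
  obtain ⟨hv0, hv, -⟩ := h
  induction i using Fin.cases with
  | zero =>
    rw [abs_householderVec_zero, householderVec_zero]
    have entry : IsApprox ((1 + u) ^ (k + 2)) |x 0| (x 0) (x 0) :=
      (IsApprox.refl le_rfl).mono (one_le_pow₀ (by linarith))
    exact (entry.add (hσ.isApprox hu)).rounds hv0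
  | succ i =>
    rw [hv, householderVec_succ]
    exact (IsApprox.refl le_rfl).mono (one_le_pow₀ (by linarith))

theorem FlHouseholderVector.isApprox_scalar (hu : 0 ≤ u) (hk : (1 + u) ^ (2 * k + 6) ≤ 3 / 2)
    (hx : 0 < ‖x‖₂) (hσ : FlSignedNorm u x σ) (h : FlHouseholderVector u x σ v β) :
    IsApprox ((1 + u) ^ (4 * k + 13)) (signedNorm x * householderVec x 0)⁻¹
      (signedNorm x * householderVec x 0)⁻¹ β := by
  have vector := h.isApprox_vector hu hσ 0
  obtain ⟨-, -, p, hp, hβ⟩ := h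
  have product : IsApprox ((1 + u) ^ (2 * k + 6)) (signedNorm x * householderVec x 0)
      (signedNorm x * householderVec x 0) p := by
    have := ((hσ.isApprox hu).mul vector).rounds hp
    rw [← signedNorm_mul_householderVec_zero] at this
    convert this using 1
    ring
  rw [one_div] at hβ
  convert (product.inv (signedNorm_mul_householderVec_zero_pos hx) hk).rounds hβ using 1
  ring

end HouseholderVector

theorem FlApplyReflector.norm_sub_mulVec_le {u : ℝ} {s a c : ℕ} (hu : 0 ≤ u)
    {v v' b y : Fin s → ℝ} {β β' : ℝ} (hv : ∀ i, IsApprox ((1 + u) ^ a) |v i| (v i) (v' i))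
    (hβ : IsApprox ((1 + u) ^ c) β β β') (hβv : β * (v ⬝ᵥ v) = 2)
    (h : FlApplyReflector u v' β' b y) :
    ‖y - reflector β v *ᵥ b‖₂ ≤ 3 * ((1 + u) ^ (c + 2 * a + s + 3) - 1) * ‖b‖₂ := by
  obtain ⟨τ, w, hτ, hw, hy⟩ := h
  have growth (j : ℕ) : 1 ≤ (1 + u) ^ j := one_le_pow₀ (by linarith)
  set W := ∑ i, |v i * b i|
  have terms (i) : IsApprox ((1 + u) ^ a) |v i * b i| (v i * b i) (v' i * b i) := by
    simpa only [abs_mul, mul_one] using (hv i).mul (IsApprox.refl (x := b i) le_rfl)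
  have inner_product : IsApprox ((1 + u) ^ a * (1 + u) ^ s) W (v ⬝ᵥ b) τ := by
    refine (IsApprox.sum fun i _ => terms i).trans
      ((hτ.isApprox_dotProduct hu).mono_scale (growth s) ?_)
    rw [Finset.mul_sum]
    exact Finset.sum_le_sum fun i _ => (terms i).abs_approx_le
  have coefficient := (hβ.mul inner_product).rounds hw
  have entrywise (i) : IsApprox ((1 + u) ^ (c + 2 * a + s + 3)) (|b i| + β * W * |v i|)
      (b i - β * (v ⬝ᵥ b) * v i) (y i) := by
    obtain ⟨p, hp, hyi⟩ := hy i
    have product := (coefficient.mul (hv i)).rounds hp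
    have growth_eq : (1 + u) ^ c * ((1 + u) ^ a * (1 + u) ^ s) * (1 + u) * (1 + u) ^ a * (1 + u) =
      (1 + u) ^ (c + 2 * a + s + 2) := by ring
    rw [growth_eq] at product
    exact (((IsApprox.refl le_rfl).mono (growth _)).sub product).rounds hyi
  have hg : 0 ≤ (1 + u) ^ (c + 2 * a + s + 3) - 1 := sub_nonneg.mpr (growth _)
  calc ‖y - reflector β v *ᵥ b‖₂
      ≤ ‖((1 + u) ^ (c + 2 * a + s + 3) - 1) • fun i => |b i| + β * W * |v i|‖₂ := by
        refine norm_toLp_mono fun i => ?_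
        rw [reflector_mulVec]
        exact (entrywise i).error_le.trans (le_abs_self _)
    _ = ((1 + u) ^ (c + 2 * a + s + 3) - 1) * ‖fun i => |b i| + β * W * |v i|‖₂ := by
        rw [WithLp.toLp_smul, norm_smul, Real.norm_of_nonneg hg]
    _ ≤ ((1 + u) ^ (c + 2 * a + s + 3) - 1) * (3 * ‖b‖₂) := by
        gcongr
        exact norm_abs_add_smul_abs_le hβ.scale_nonneg hβv b
    _ = 3 * ((1 + u) ^ (c + 2 * a + s + 3) - 1) * ‖b‖₂ := by ring

section ColumnwiseApproximation

variable {l m n : Type*} [Fintype l] [Fintype m] {g h : ℝ}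

/-- `D` approximates `B` columnwise with growth factor `g`; the matrix counterpart of
`IsApprox`. -/
def IsColApprox (g : ℝ) (B D : Matrix m n ℝ) : Prop :=
  ∀ j, ‖(D - B).col j‖₂ ≤ (g - 1) * ‖B.col j‖₂

namespace IsColApprox

theorem mono {B D : Matrix m n ℝ} (hBD : IsColApprox g B D) (hgh : g ≤ h) : IsColApprox h B D :=
  fun j => (hBD j).trans (by gcongr)

theorem trans {B M D : Matrix m n ℝ} (hBM : IsColApprox g B M) (hMD : IsColApprox h M D)
    (hh : 1 ≤ h) : IsColApprox (g * h) B D := by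
  intro j
  have hM : ‖M.col j‖₂ ≤ g * ‖B.col j‖₂ := by
    have := norm_sub_norm_le (WithLp.toLp 2 (M.col j)) (WithLp.toLp 2 (B.col j))
    have := this.trans (hBM j)
    linarith
  calc ‖(D - B).col j‖₂ ≤ ‖(D - M).col j‖₂ + ‖(M - B).col j‖₂ := by
        refine le_trans (le_of_eq ?_) (norm_add_le _ _)
        rw [← WithLp.toLp_add]
        congr 2
        ext i
        simp
    _ ≤ (h - 1) * (g * ‖B.col j‖₂) + (g - 1) * ‖B.col j‖₂ := by
        have : 0 ≤ h - 1 := by linarith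
        grw [hMD j, hBM j, hM]
    _ = (g * h - 1) * ‖B.col j‖₂ := by ring

theorem mul_left [DecidableEq m] {P : Matrix l m ℝ} (hP : Pᵀ * P = 1) {B D : Matrix m n ℝ}
    (hBD : IsColApprox g B D) : IsColApprox g (P * B) (P * D) := by
  intro j
  have col_mul (M : Matrix m n ℝ) : ‖(P * M).col j‖₂ = ‖M.col j‖₂ :=
    norm_mulVec_of_transpose_mul_self_eq_one hP (M.col j)
  rw [← Matrix.mul_sub, col_mul, col_mul]
  exact hBD j

end IsColApprox

end ColumnwiseApproximation

section Bordered

variable {R : Type*} [Ring R] {l m n : ℕ}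

/-- The block matrix `[[a, r], [0, M]]`, in which `M` is the trailing submatrix. -/
def bordered (a : R) (r : Fin n → R) (M : Matrix (Fin m) (Fin n) R) :
    Matrix (Fin (m + 1)) (Fin (n + 1)) R :=
  Matrix.of (Fin.cons (Fin.cons a r) fun i => Fin.cons 0 (M i))

theorem bordered_mul_bordered (a a' : R) (r : Fin m → R) (r' : Fin n → R)
    (M : Matrix (Fin l) (Fin m) R) (M' : Matrix (Fin m) (Fin n) R) :
    bordered a r M * bordered a' r' M' = bordered (a * a') (a • r' + r ᵥ* M') (M * M') := by
  ext i j
  induction i using Fin.cases <;> induction j using Fin.cases <;>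
    simp [bordered, Matrix.mul_apply, Fin.sum_univ_succ, Matrix.vecMul, dotProduct]

theorem bordered_zero_transpose (a : R) (M : Matrix (Fin m) (Fin n) R) :
    (bordered a 0 M)ᵀ = bordered a 0 Mᵀ := by
  ext i j
  induction i using Fin.cases <;> induction j using Fin.cases <;> simp [bordered]

theorem bordered_one_zero_one : bordered 1 0 (1 : Matrix (Fin n) (Fin n) R) = 1 := by
  ext i j
  induction i using Fin.cases <;> induction j using Fin.cases <;>
    simp [bordered, Matrix.one_apply, Fin.succ_ne_zero, (Fin.succ_ne_zero _).symm]

theorem eq_bordered {M : Matrix (Fin (m + 1)) (Fin (n + 1)) R} (h : ∀ i : Fin m, M i.succ 0 = 0) :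
    M = bordered (M 0 0) (fun j => M 0 j.succ) (M.submatrix Fin.succ Fin.succ) := by
  ext i j
  induction i using Fin.cases <;> induction j using Fin.cases <;> simp [bordered, h]

theorem bordered_upper {a : R} {r : Fin n → R} {M : Matrix (Fin n) (Fin n) R}
    (hM : ∀ i j, j < i → M i j = 0) (i j : Fin (n + 1)) (hij : j < i) : bordered a r M i j = 0 := by
  induction i using Fin.cases with
  | zero => exact absurd hij (Fin.not_lt_zero j)
  | succ i =>
    induction j using Fin.cases with
    | zero => rfl
    | succ j => exact hM i j (Fin.succ_lt_succ_iff.mp hij)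

theorem IsEconomyQR.bordered {D Q : Matrix (Fin m) (Fin n) ℝ} {R : Matrix (Fin n) (Fin n) ℝ}
    (h : IsEconomyQR D Q R) {P : Matrix (Fin (m + 1)) (Fin (m + 1)) ℝ} (hP : Pᵀ * P = 1) (a : ℝ)
    (r : Fin n → ℝ) :
    IsEconomyQR (P * bordered a r D) (P * bordered 1 0 Q) (bordered a r R) where
  orthonormal := by
    rw [Matrix.transpose_mul, Matrix.mul_assoc, ← Matrix.mul_assoc Pᵀ, hP, Matrix.one_mul,
      bordered_zero_transpose, bordered_mul_bordered, h.orthonormal, mul_one, smul_zero,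
      Matrix.zero_vecMul, add_zero, bordered_one_zero_one]
  upper := bordered_upper h.upper
  eq := by
    rw [Matrix.mul_assoc, bordered_mul_bordered, ← h.eq, one_mul, one_smul, Matrix.zero_vecMul,
      add_zero]

theorem bordered_col_zero (a : R) (r : Fin n → R) (M : Matrix (Fin m) (Fin n) R) :
    (bordered a r M).col 0 = Pi.single 0 a := by
  ext i
  induction i using Fin.cases <;> simp [bordered]

theorem bordered_col_succ (a : R) (C : Matrix (Fin (m + 1)) (Fin n) R) (j : Fin n) :
    (bordered a (C 0) (C.submatrix Fin.succ id)).col j.succ = C.col j := by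
  ext i
  induction i using Fin.cases <;> simp [bordered]

theorem norm_bordered_col_succ_sq (a : ℝ) (r : Fin n → ℝ) (M : Matrix (Fin m) (Fin n) ℝ)
    (j : Fin n) : ‖(bordered a r M).col j.succ‖₂ ^ 2 = r j ^ 2 + ‖M.col j‖₂ ^ 2 := by
  rw [norm_toLp_sq, norm_toLp_sq, Fin.sum_univ_succ]
  simp [bordered]

theorem bordered_sub_bordered (a : R) (r : Fin n → R) (M M' : Matrix (Fin m) (Fin n) R) :
    bordered a r M - bordered a r M' = bordered 0 0 (M - M') := by
  ext i j
  induction i using Fin.cases <;> induction j using Fin.cases <;> simp [bordered]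

theorem IsColApprox.bordered {g : ℝ} (hg : 1 ≤ g) {B D : Matrix (Fin m) (Fin n) ℝ}
    (hBD : IsColApprox g B D) (a : ℝ) (r : Fin n → ℝ) :
    IsColApprox g (bordered a r B) (bordered a r D) := by
  have : 0 ≤ g - 1 := by linarith
  intro j
  rw [bordered_sub_bordered]
  induction j using Fin.cases with
  | zero =>
    rw [bordered_col_zero, Pi.single_zero, WithLp.toLp_zero, norm_zero]
    positivity
  | succ j =>
    refine le_of_sq_le_sq ?_ (by positivity)
    rw [mul_pow, norm_bordered_col_succ_sq, norm_bordered_col_succ_sq, Pi.zero_apply]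
    grw [hBD j, ← sq_nonneg (r j)]
    exact le_of_eq (by ring)

end Bordered

section HouseholderQR

variable {u : ℝ}

theorem FlHouseholderVector.exists_orthogonal {k : ℕ} (hu : 0 ≤ u)
    (hk : (1 + u) ^ (2 * k + 6) ≤ 3 / 2) {x v : Fin (k + 1) → ℝ} {σ β : ℝ} (hσ0 : σ ≠ 0)
    (hσ : FlSignedNorm u x σ) (h : FlHouseholderVector u x σ v β) :
    ∃ P : Matrix (Fin (k + 1)) (Fin (k + 1)) ℝ, Pᵀ * P = 1 ∧
      ‖P *ᵥ Pi.single 0 (-σ) - x‖₂ ≤ ((1 + u) ^ (k + 2) - 1) * ‖x‖₂ ∧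
      ∀ b y, FlApplyReflector u v β b y →
        ‖P *ᵥ y - b‖₂ ≤ ((1 + u) ^ (69 * (k + 1)) - 1) * ‖b‖₂ := by
  have hx : 0 < ‖x‖₂ := by
    refine (norm_nonneg _).lt_of_ne' fun hx => hσ0 ?_
    simpa [hx] using (hσ.isApprox hu).abs_approx_le
  have hβ := inv_mul_householderVec_dotProduct_self hx
  refine ⟨_, reflector_transpose_mul_self hβ, ?_, fun b y hy => ?_⟩
  · rw [norm_reflector_mulVec_sub hβ, reflector_householderVec_mulVec hx, ← Pi.single_sub,
      PiLp.toLp_single, PiLp.norm_single, Real.norm_eq_abs, neg_sub_neg, abs_sub_comm]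
    exact (hσ.isApprox hu).error_le
  · rw [norm_reflector_mulVec_sub hβ]
    refine (hy.norm_sub_mulVec_le hu (h.isApprox_vector hu hσ) (h.isApprox_scalar hu hk hx hσ)
      hβ).trans ?_
    gcongr
    refine (three_mul_sub_one_le_pow_three (one_le_pow₀ (by linarith))).trans ?_
    rw [← pow_mul]
    -- `3 * ((4k + 13) + 2(k + 3) + (k + 1) + 3) = 21k + 69 ≤ 69(k + 1)`
    exact sub_le_sub_right (pow_le_pow_right₀ (by linarith) (by omega)) 1

theorem isColApprox_mul_bordered {m n : ℕ} {g a : ℝ} {B : Matrix (Fin (m + 1)) (Fin (n + 1)) ℝ}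
    {C : Matrix (Fin (m + 1)) (Fin n) ℝ} {P : Matrix (Fin (m + 1)) (Fin (m + 1)) ℝ}
    (h₀ : ‖P *ᵥ Pi.single 0 a - B.col 0‖₂ ≤ (g - 1) * ‖B.col 0‖₂)
    (hC : ∀ j, ‖P *ᵥ C.col j - B.col j.succ‖₂ ≤ (g - 1) * ‖B.col j.succ‖₂) :
    IsColApprox g B (P * bordered a (C 0) (C.submatrix Fin.succ id)) := by
  intro j
  change ‖P *ᵥ (bordered a (C 0) (C.submatrix Fin.succ id)).col j - B.col j‖₂ ≤ _
  induction j using Fin.cases with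
  | zero => rwa [bordered_col_zero]
  | succ j =>
    rw [bordered_col_succ]
    exact hC j

theorem FlHouseholderQR.exists_orthogonal_of_step {s n : ℕ} (hu : 0 ≤ u)
    (hs : (1 + u) ^ (2 * s + 6) ≤ 3 / 2) {B : Matrix (Fin (s + 1)) (Fin (n + 1)) ℝ}
    {C : Matrix (Fin (s + 1)) (Fin n) ℝ} {σ : ℝ} (hσ : FlSignedNorm u (B.col 0) σ)
    (hskip : σ = 0 → ∀ i j, C i j = B i j.succ)
    (hreflect : σ ≠ 0 → ∃ v β, FlHouseholderVector u (B.col 0) σ v β ∧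
      ∀ j, FlApplyReflector u v β (B.col j.succ) (C.col j)) :
    ∃ P : Matrix (Fin (s + 1)) (Fin (s + 1)) ℝ, Pᵀ * P = 1 ∧ IsColApprox ((1 + u) ^ (69 * (s + 1)))
      B (P * bordered (-σ) (C 0) (C.submatrix Fin.succ id)) := by
  have pow_le : (1 + u) ^ (s + 2) ≤ (1 + u) ^ (69 * (s + 1)) := by
    gcongr
    · linarith
    · omega
  by_cases hσ0 : σ = 0
  · refine ⟨1, by simp, isColApprox_mul_bordered ?_ fun j => ?_⟩
    · have := (hσ.isApprox hu).error_le
      rw [hσ0, zero_sub, abs_neg, abs_signedNorm] at this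
      rw [Matrix.one_mulVec, hσ0, neg_zero, Pi.single_zero, zero_sub, WithLp.toLp_neg, norm_neg]
      exact this.trans (by gcongr)
    · rw [Matrix.one_mulVec, show C.col j = B.col j.succ from funext fun i => hskip hσ0 i j,
        sub_self, WithLp.toLp_zero, norm_zero]
      exact mul_nonneg (sub_nonneg.mpr (one_le_pow₀ (by linarith))) (norm_nonneg _)
  · obtain ⟨v, β, hv, hC⟩ := hreflect hσ0
    obtain ⟨P, hP, first_col, other_cols⟩ := hv.exists_orthogonal hu hs hσ0 hσ
    exact ⟨P, hP, isColApprox_mul_bordered (first_col.trans (by gcongr)) fun j =>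
      other_cols _ _ (hC j)⟩

theorem FlHouseholderQR.exists_isEconomyQR (hu : 0 ≤ u) {s n : ℕ} (hs : 69 * s * u < 1)
    {B : Matrix (Fin s) (Fin n) ℝ} {R : Matrix (Fin n) (Fin n) ℝ} (h : FlHouseholderQR u B R) :
    ∃ D Q : Matrix (Fin s) (Fin n) ℝ, IsEconomyQR D Q R ∧
      IsColApprox ((1 + u) ^ (69 * s * n)) B D := by
  induction n generalizing s with
  | zero =>
    exact ⟨B, 0, ⟨Subsingleton.elim _ _, fun i => i.elim0, Subsingleton.elim _ _⟩,
      fun j => j.elim0⟩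
  | succ n ih =>
    cases s with
    | zero => simp [FlHouseholderQR] at h
    | succ s =>
      obtain ⟨σ, C, hσ, hskip, hreflect, hR00, hR0, hR, hrec⟩ := h
      push_cast at hs
      obtain ⟨P, hP, hBP⟩ := FlHouseholderQR.exists_orthogonal_of_step hu
        (one_add_pow_le_three_halves hu (by push_cast; nlinarith)) hσ hskip hreflect
      obtain ⟨D, Q, hDQ, hCD⟩ := ih (by linarith) hrec
      have growth (j : ℕ) : 1 ≤ (1 + u) ^ j := one_le_pow₀ (by linarith)
      refine ⟨P * bordered (-σ) (C 0) D, P * bordered 1 0 Q, ?_, ?_⟩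
      · rw [eq_bordered hR, hR00, funext hR0]
        exact hDQ.bordered hP _ _
      · refine (hBP.trans ((hCD.bordered (growth _) _ _).mul_left hP) (growth _)).mono ?_
        rw [← pow_add]
        gcongr
        · linarith
        · nlinarith

end HouseholderQR

section Constants

variable {u : ℝ} {k l m n s c : ℕ}

theorem gam_mono (hu : 0 ≤ u) (hkl : k ≤ l) (hl : l * u < 1) : gam u k ≤ gam u l := by
  have hkl' : (k : ℝ) * u ≤ l * u := by gcongr
  exact div_le_div₀ (by positivity) hkl' (by linarith) (by linarith)

theorem mul_gam_le_mul_gam (hu : 0 ≤ u) (hkl : k ≤ l) (hl : l * u < 1) :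
    l * gam u k ≤ k * gam u l := by
  have hkl' : (k : ℝ) * u ≤ l * u := by gcongr
  rw [gam, gam, mul_div_assoc', mul_div_assoc', mul_left_comm]
  exact div_le_div_of_nonneg_left (by positivity) (by linarith) (by linarith)

theorem mul_gam_le_gam_mul (hu : 0 ≤ u) (hn : 0 < n) (h : ((n * k : ℕ) : ℝ) * u < 1) :
    n * gam u k ≤ gam u (n * k) := by
  have hk : (k : ℝ) * u ≤ ((n * k : ℕ) : ℝ) * u := by
    gcongr
    exact Nat.le_mul_of_pos_left k hn
  rw [gam, gam, mul_div_assoc', Nat.cast_mul, mul_assoc]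
  rw [Nat.cast_mul, mul_assoc] at h hk
  exact div_le_div_of_nonneg_left (by positivity) (by linarith) (by linarith)

theorem mul_gam_le_C₁ (hu : 0 ≤ u) (hc : 0 < c) (hn : 0 < n) (hns : n ≤ s) (hnm : n ≤ m)
    (hm : m * u < 1) (hs : ((c * s * n : ℕ) : ℝ) * u < 1) :
    (m / n + √n) * (n * gam u n) ≤ C₁ c u m s n := by
  have hnn : n * n ≤ c * s * n := Nat.mul_le_mul_right n (hns.trans (Nat.le_mul_of_pos_left s hc))
  have hnn_lt : ((n * n : ℕ) : ℝ) * u < 1 := lt_of_le_of_lt (by gcongr) hs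
  have hγm := gam_nonneg hu hm
  have hγs := gam_nonneg hu hs
  have le_sqrt : (n : ℝ) ≤ √(s * n) := by
    refine Real.le_sqrt_of_sq_le ?_
    rw [pow_two]
    gcongr
  calc (m / n + √n) * (n * gam u n) = m * gam u n + √n * (n * gam u n) := by field_simp
    _ ≤ n * gam u m + √n * gam u (n * n) := by
        grw [mul_gam_le_mul_gam hu hnm hm, mul_gam_le_gam_mul hu hn hnn_lt]
    _ ≤ √(s * n) * gam u m + √n * gam u (c * s * n) := by
        gcongr
        exact gam_mono hu hnn hs
    _ ≤ C₁ c u m s n := by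
        have : 0 ≤ √n * gam u (c * s * n) * (√(s * n) * gam u m) := by positivity
        rw [C₁]
        linarith

end Constants

section Sketch

variable {m s n : ℕ}

theorem FlHouseholderQR.exists_isEconomyQR_norm_sub_le {u : ℝ} (hu : 0 ≤ u) (hn : 0 < n)
    (hs : ((69 * s * n : ℕ) : ℝ) * u < 1) {B : Matrix (Fin s) (Fin n) ℝ}
    {R : Matrix (Fin n) (Fin n) ℝ} (h : FlHouseholderQR u B R) :
    ∃ D Q : Matrix (Fin s) (Fin n) ℝ, IsEconomyQR D Q R ∧
      ‖D - B‖ ≤ √n * gam u (69 * s * n) * ‖B‖ := by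
  have hs' : 69 * s * u < 1 := by
    refine lt_of_le_of_lt ?_ hs
    gcongr
    exact_mod_cast Nat.le_mul_of_pos_right (69 * s) hn
  obtain ⟨D, Q, hQ, hBD⟩ := h.exists_isEconomyQR hu hs'
  have columns := hBD.mono (one_add_pow_le_one_add_gam hu hs)
  rw [IsColApprox, add_sub_cancel_left] at columns
  refine ⟨D, Q, hQ, (norm_le_of_norm_col_le (gam_nonneg hu hs) columns).trans_eq ?_⟩
  rw [Fintype.card_fin]
  ring

theorem exists_sketch_perturbation {u : ℝ} (hu : 0 ≤ u) (hn : 0 < n) (hm : m * u < 1)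
    (hs : ((69 * s * n : ℕ) : ℝ) * u < 1) {S : Matrix (Fin s) (Fin m) ℝ}
    {A : Matrix (Fin m) (Fin n) ℝ} {B : Matrix (Fin s) (Fin n) ℝ} {R : Matrix (Fin n) (Fin n) ℝ}
    (hB : FlMatMul u S A B) (hR : FlHouseholderQR u B R) :
    ∃ E Q : Matrix (Fin s) (Fin n) ℝ, IsEconomyQR (S * A + E) Q R ∧
      ‖E‖ ≤ C₁ 69 u m s n * (‖S‖ * ‖A‖) := by
  obtain ⟨D, Q, hQ, hDB⟩ := hR.exists_isEconomyQR_norm_sub_le hu hn hs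
  have hBSA := hB.norm_sub_le hu hm
  have hγ := gam_nonneg hu hs
  have norm_B_le : ‖B‖ ≤ (1 + √(s * n) * gam u m) * (‖S‖ * ‖A‖) := by
    grw [← sub_add_cancel B (S * A), norm_add_le, hBSA, Matrix.l2_opNorm_mul]
    exact le_of_eq (by ring)
  refine ⟨D - S * A, Q, by rwa [add_sub_cancel], ?_⟩
  calc ‖D - S * A‖ ≤ ‖D - B‖ + ‖B - S * A‖ := norm_sub_le_norm_sub_add_norm_sub _ _ _
    _ ≤ √n * gam u (69 * s * n) * ((1 + √(s * n) * gam u m) * (‖S‖ * ‖A‖)) +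
        √(s * n) * gam u m * (‖S‖ * ‖A‖) := by grw [hDB, hBSA, norm_B_le]
    _ = C₁ 69 u m s n * (‖S‖ * ‖A‖) := by rw [C₁]; ring

theorem one_le_kS [NeZero n] {A Q : Matrix (Fin m) (Fin n) ℝ} {R : Matrix (Fin n) (Fin n) ℝ}
    {S : Matrix (Fin s) (Fin m) ℝ} (hQ : IsEconomyQR A Q R)
    (hSQ : LinearIndependent ℝ (S * Q).col) : 1 ≤ kS S Q := by
  have norm_Q_le : ‖Q‖ ≤ 1 := norm_le_of_norm_mulVec_le zero_le_one fun x => by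
    rw [norm_mulVec_of_transpose_mul_self_eq_one hQ.orthonormal, one_mul]
  grw [one_le_norm_mul_norm_pinv hSQ, Matrix.l2_opNorm_mul, norm_Q_le, mul_one]
  rfl

theorem IsEconomyQR.norm_le {A E P : Matrix (Fin m) (Fin n) ℝ} {R : Matrix (Fin n) (Fin n) ℝ}
    (hR : IsEconomyQR (A + E) P R) : ‖R‖ ≤ ‖A‖ + ‖E‖ :=
  norm_le_of_norm_mulVec_le (by positivity) fun x => by
    grw [← hR.norm_mulVec, norm_mulVec_le, norm_add_le]

variable {A Q : Matrix (Fin m) (Fin n) ℝ} {RA R : Matrix (Fin n) (Fin n) ℝ}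
  {S : Matrix (Fin s) (Fin m) ℝ} {E P : Matrix (Fin s) (Fin n) ℝ} {c : ℝ}

/- `SA = (SQ)R_A` gives `‖Ax‖ ≤ ‖(SQ)†‖ ‖SAx‖ ≤ ‖(SQ)†‖ (‖Rx‖ + ‖E‖ ‖A†‖ ‖Ax‖)`, where the factor
of `‖Ax‖` on the right is at most `1/3`. -/
theorem norm_mulVec_le_of_sketch (hA : LinearIndependent ℝ A.col) (hQ : IsEconomyQR A Q RA)
    (hSQ : LinearIndependent ℝ (S * Q).col) (hR : IsEconomyQR (S * A + E) P R)
    (hE : ‖E‖ ≤ c * (‖S‖ * ‖A‖)) (hc : 3 * c * kS S Q * (‖A‖ * ‖pinv A‖) ≤ 1) (x : Fin n → ℝ) :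
    ‖A *ᵥ x‖₂ ≤ 3 / 2 * ‖pinv (S * Q)‖ * ‖R *ᵥ x‖₂ := by
  have sketch_embeds : ‖A *ᵥ x‖₂ ≤ ‖pinv (S * Q)‖ * ‖(S * A) *ᵥ x‖₂ := by
    have := norm_le_norm_pinv_mul hSQ (RA *ᵥ x)
    rwa [Matrix.mulVec_mulVec, Matrix.mul_assoc, ← hQ.eq, ← hQ.norm_mulVec] at this
  have sketch_le : ‖(S * A) *ᵥ x‖₂ ≤ ‖R *ᵥ x‖₂ + ‖E *ᵥ x‖₂ := by
    rw [← hR.norm_mulVec, Matrix.add_mulVec, WithLp.toLp_add]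
    exact norm_le_add_norm_add _ _
  have perturbation_le : ‖E *ᵥ x‖₂ ≤ c * (‖S‖ * ‖A‖) * (‖pinv A‖ * ‖A *ᵥ x‖₂) :=
    (norm_mulVec_le E x).trans (mul_le_mul hE (norm_le_norm_pinv_mul hA x) (norm_nonneg _)
      ((norm_nonneg E).trans hE))
  have absorbed := mul_le_mul_of_nonneg_right hc (norm_nonneg (WithLp.toLp 2 (A *ᵥ x)))
  have := mul_le_mul_of_nonneg_left (sketch_le.trans (add_le_add_right perturbation_le _))
    (norm_nonneg (pinv (S * Q)))
  rw [kS] at absorbed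
  linarith

theorem isUnit_det_of_norm_mulVec_le {a : ℝ} (hA : LinearIndependent ℝ A.col)
    (h : ∀ x, ‖A *ᵥ x‖₂ ≤ a * ‖R *ᵥ x‖₂) : IsUnit R.det := by
  refine isUnit_iff_ne_zero.mpr fun hdet => ?_
  obtain ⟨x, hx, hRx⟩ := Matrix.exists_mulVec_eq_zero_iff.mpr hdet
  refine hx (Matrix.mulVec_injective_iff.mpr hA ?_)
  simpa [hRx] using h x

theorem norm_mul_inv_le {a : ℝ} (hR : IsUnit R.det) (ha : 0 ≤ a)
    (h : ∀ x, ‖A *ᵥ x‖₂ ≤ a * ‖R *ᵥ x‖₂) : ‖A * R⁻¹‖ ≤ a :=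
  norm_le_of_norm_mulVec_le ha fun w => by
    simpa [Matrix.mulVec_mulVec, Matrix.mul_nonsing_inv R hR] using h (R⁻¹ *ᵥ w)

theorem diag_ne_zero_of_isUnit_det (hupper : ∀ i j, j < i → R i j = 0) (hR : IsUnit R.det)
    (i : Fin n) : R i i ≠ 0 := by
  have h := hR.ne_zero
  rw [Matrix.det_of_isUpperTriangular fun i j hij => hupper i j hij] at h
  exact Finset.prod_ne_zero_iff.mp h i (Finset.mem_univ i)

theorem norm_le_add_mul_of_norm_sub_mul_le {Y : Matrix (Fin m) (Fin n) ℝ} {g : ℝ}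
    (hR : IsUnit R.det) (h : ‖A - Y * R‖ ≤ g * (‖Y‖ * ‖R‖)) :
    ‖Y‖ ≤ ‖A * R⁻¹‖ + g * (‖R‖ * ‖R⁻¹‖) * ‖Y‖ := by
  have Y_eq : Y = A * R⁻¹ - (A - Y * R) * R⁻¹ := by
    rw [← Matrix.sub_mul, sub_sub_cancel, Matrix.mul_assoc, Matrix.mul_nonsing_inv R hR,
      Matrix.mul_one]
  calc ‖Y‖ ≤ ‖A * R⁻¹‖ + ‖A - Y * R‖ * ‖R⁻¹‖ := by
        conv_lhs => rw [Y_eq]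
        grw [norm_sub_le, Matrix.l2_opNorm_mul (A - Y * R)]
    _ ≤ ‖A * R⁻¹‖ + g * (‖R‖ * ‖R⁻¹‖) * ‖Y‖ := by
        grw [h]
        exact le_of_eq (by ring)

theorem norm_preconditioned_le {Y : Matrix (Fin m) (Fin n) ℝ} {g : ℝ}
    (hA : LinearIndependent ℝ A.col) (hRdet : IsUnit R.det)
    (hR : ‖R‖ ≤ 4 / 3 * (‖S‖ * ‖A‖)) (hAR : ∀ x, ‖A *ᵥ x‖₂ ≤ 3 / 2 * ‖pinv (S * Q)‖ * ‖R *ᵥ x‖₂)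
    (hg : 0 ≤ g) (hg' : 600 * g * kS S Q * (‖A‖ * ‖pinv A‖) ≤ 1)
    (hY : ‖A - Y * R‖ ≤ g * (‖Y‖ * ‖R‖)) : ‖Y‖ ≤ 1.51 * ‖pinv (S * Q)‖ := by
  have norm_inv_le : ‖R⁻¹‖ ≤ 3 / 2 * ‖pinv (S * Q)‖ * ‖pinv A‖ := by
    rw [← Matrix.one_mul R⁻¹]
    refine norm_mul_inv_le hRdet (by positivity) fun x => ?_
    rw [Matrix.one_mulVec]
    grw [norm_le_norm_pinv_mul hA x, hAR x]
    exact le_of_eq (by ring)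
  have contraction : g * (‖R‖ * ‖R⁻¹‖) ≤ 1 / 300 := by
    grw [hR, norm_inv_le]
    rw [kS] at hg'
    linarith
  have := norm_le_add_mul_of_norm_sub_mul_le hRdet hY
  grw [contraction, norm_mul_inv_le hRdet (by positivity) hAR] at this
  linarith [norm_nonneg (pinv (S * Q))]

theorem norm_add_mul_add_sub_lt {Y ΔY : Matrix (Fin m) (Fin n) ℝ} {ΔR : Matrix (Fin n) (Fin n) ℝ}
    {a g p : ℝ} (ha : 0 < a) (hg : 0 < g) (hg' : g ≤ 1 / 600) (hp : 0 < p)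
    (hY : ‖Y‖ ≤ 1.51 * p) (hR : ‖R‖ ≤ 4 / 3 * a) (hAYR : ‖A - Y * R‖ ≤ g * (‖Y‖ * ‖R‖))
    (hΔR : ‖ΔR‖ ≤ g * ‖R‖) :
    ‖(Y + ΔY) * (R + ΔR) - A‖ < a * (6.04 * g * p + 2.01 * ‖ΔY‖) := by
  have split : (Y + ΔY) * (R + ΔR) - A = -(A - Y * R) + Y * ΔR + ΔY * (R + ΔR) := by
    rw [Matrix.add_mul, Matrix.mul_add Y]
    abel
  have hagp : 0 < a * g * p := by positivity
  calc ‖(Y + ΔY) * (R + ΔR) - A‖ ≤ ‖A - Y * R‖ + ‖Y‖ * ‖ΔR‖ + ‖ΔY‖ * (‖R‖ + ‖ΔR‖) := by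
        grw [split, norm_add₃_le, norm_neg, Matrix.l2_opNorm_mul, Matrix.l2_opNorm_mul,
          norm_add_le R]
    _ ≤ g * (‖Y‖ * ‖R‖) + ‖Y‖ * (g * ‖R‖) + ‖ΔY‖ * (‖R‖ + g * ‖R‖) := by grw [hAYR, hΔR]
    _ = (2 * g * ‖Y‖ + (1 + g) * ‖ΔY‖) * ‖R‖ := by ring
    _ ≤ (2 * g * (1.51 * p) + (1 + 1 / 600) * ‖ΔY‖) * (4 / 3 * a) := by
        gcongr
    _ < a * (6.04 * g * p + 2.01 * ‖ΔY‖) := by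
        linarith [mul_nonneg ha.le (norm_nonneg ΔY)]

theorem norm_backward_error_lt [NeZero n] {Y ΔY : Matrix (Fin m) (Fin n) ℝ}
    {ΔR : Matrix (Fin n) (Fin n) ℝ} {g : ℝ} (hA : LinearIndependent ℝ A.col)
    (hQ : IsEconomyQR A Q RA) (hSQ : LinearIndependent ℝ (S * Q).col)
    (hR : IsEconomyQR (S * A + E) P R) (hE : ‖E‖ ≤ c * (‖S‖ * ‖A‖))
    (hc : 3 * c * kS S Q * (‖A‖ * ‖pinv A‖) ≤ 1) (hg : 0 < g) (hgc : 200 * g ≤ c)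
    (hAYR : ‖A - Y * R‖ ≤ g * (‖Y‖ * ‖R‖)) (hΔR : ‖ΔR‖ ≤ g * ‖R‖) :
    ‖(Y + ΔY) * (R + ΔR) - A‖ <
      ‖S‖ * ‖A‖ * (6.04 * g * ‖pinv (S * Q)‖ + 2.01 * ‖ΔY‖) := by
  have one_le_κ := one_le_norm_mul_norm_pinv hA
  have one_le_k := one_le_kS hQ hSQ
  have c_pos : 0 < c := by linarith
  have c_le : 3 * c ≤ 1 := by
    refine le_trans ?_ hc
    rw [mul_assoc (3 * c)]
    exact le_mul_of_one_le_right (by positivity) (one_le_mul_of_one_le_of_one_le one_le_k one_le_κ)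
  have hAR := norm_mulVec_le_of_sketch hA hQ hSQ hR hE hc
  have norm_R_le : ‖R‖ ≤ 4 / 3 * (‖S‖ * ‖A‖) := by
    have := mul_le_mul_of_nonneg_right c_le (show 0 ≤ ‖S‖ * ‖A‖ by positivity)
    linarith [hR.norm_le, Matrix.l2_opNorm_mul S A]
  have norm_Y_le : ‖Y‖ ≤ 1.51 * ‖pinv (S * Q)‖ := by
    refine norm_preconditioned_le hA (isUnit_det_of_norm_mulVec_le hA hAR) norm_R_le hAR hg.le
      (le_trans ?_ hc) hAYR
    gcongr ?_ * kS S Q * _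
    linarith
  have hSA : 0 < ‖S‖ * ‖A‖ :=
    mul_pos (pos_of_mul_pos_left (zero_lt_one.trans_le one_le_k) (norm_nonneg _))
      (pos_of_mul_pos_left (zero_lt_one.trans_le one_le_κ) (norm_nonneg _))
  exact norm_add_mul_add_sub_lt hSA hg (by linarith)
    (pos_of_mul_pos_right (zero_lt_one.trans_le one_le_k) (norm_nonneg _)) norm_Y_le norm_R_le
    hAYR hΔR

end Sketch

end SketchApply

theorem mainTheorem2_general {m s n : ℕ} {u : ℝ} {A QA : Matrix (Fin m) (Fin n) ℝ}
    {RA : Matrix (Fin n) (Fin n) ℝ} {S : Matrix (Fin s) (Fin m) ℝ} (hu : 0 < u)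
    (hm : m * u < 1) (hs : ((69 * s * n : ℕ) : ℝ) * u < 1) (hQ : IsEconomyQR A QA RA)
    (hSQ : LinearIndependent ℝ (S * QA).col) (hmn : (m : ℝ) / n + √n > 200)
    (hκ : condNum A < ENNReal.ofReal (1 / (3 * C₁ 69 u m s n * kS S QA)))
    {B : Matrix (Fin s) (Fin n) ℝ} {R : Matrix (Fin n) (Fin n) ℝ} {Y : Matrix (Fin m) (Fin n) ℝ}
    (hB : FlMatMul u S A B) (hR : FlHouseholderQR u B R) (hY : FlRightTriSolve u R A Y)
    {b δb : Fin m → ℝ} {ΔY : Matrix (Fin m) (Fin n) ℝ} {z x : Fin n → ℝ}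
    (hz : z = pinv (Y + ΔY) *ᵥ (b + δb)) (hx : FlBackSub u R z x) :
    ∃ ΔA : Matrix (Fin m) (Fin n) ℝ,
      IsLeastSquaresSolution (A + ΔA) (b + δb) x ∧
      ‖ΔA‖ < ‖S‖ * ‖A‖ * (6.04 * n * gam u n * ‖pinv (S * QA)‖ + 2.01 * ‖ΔY‖) := by
  have hn : 0 < n := Nat.pos_of_ne_zero fun h => by norm_num [h] at hmn
  have : NeZero n := ⟨hn.ne'⟩
  have hA := linearIndependent_of_condNum_lt hκ
  have hnm := le_of_linearIndependent_col hA
  have hnu : n * u < 1 := lt_of_le_of_lt (by gcongr) hm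
  have hu1 : u < 1 := lt_of_le_of_lt (le_mul_of_one_le_left hu.le (mod_cast hn)) hnu
  have hg : 0 < n * gam u n := mul_pos (by positivity) (div_pos (by positivity) (by linarith))
  have hgC : 200 * (n * gam u n) ≤ C₁ 69 u m s n := by
    grw [← mul_gam_le_C₁ hu.le (by norm_num) hn (le_of_linearIndependent_col hSQ) hnm hm hs, hmn]
  have hkS := one_le_kS hQ hSQ
  have hC₀ : 0 < C₁ 69 u m s n := by linarith
  have hC := (mul_norm_mul_norm_pinv_lt_one_of_condNum_lt (by positivity) hκ).le
  obtain ⟨E, P, hP, hE⟩ := exists_sketch_perturbation hu.le hn hm hs hB hR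
  have hdiag := diag_ne_zero_of_isUnit_det hP.upper <|
    isUnit_det_of_norm_mulVec_le hA (norm_mulVec_le_of_sketch hA hQ hSQ hP hE hC)
  obtain ⟨ΔR, hΔR, hΔRx⟩ := hx.exists_perturbation hu.le hu1 hnu hP.upper hdiag
  have hΔR' : ‖ΔR‖ ≤ n * gam u n * ‖R‖ := by
    refine hΔR.trans ?_
    gcongr
    · exact gam_nonneg hu.le hnu
    · exact Real.sqrt_le_self_iff.mpr (.inr (mod_cast hn))
  refine ⟨(Y + ΔY) * (R + ΔR) - A, ?_, ?_⟩
  · rw [add_sub_cancel]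
    refine IsLeastSquaresSolution.of_mulVec ?_
    rw [hΔRx, hz]
    exact isLeastSquaresSolution_pinv _ _
  · rw [mul_assoc (6.04 : ℝ)]
    exact norm_backward_error_lt hA hQ hSQ hP hE hC hg hgC
      (hY.norm_sub_mul_le hu.le hu1 hnu hP.upper hdiag) hΔR'

theorem mainTheorem2 :
    ∃ c : ℕ, 0 < c ∧
      ∀ (m s n : ℕ) (u : ℝ) (A QA : Matrix (Fin m) (Fin n) ℝ) (RA : Matrix (Fin n) (Fin n) ℝ)
        (S : Matrix (Fin s) (Fin m) ℝ),
        n < s → s < m → 0 < u →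
        -- the quantities `γ_m` and `γ̃_{sn}` are meaningful
        m * u < 1 → ((c * s * n : ℕ) : ℝ) * u < 1 →
        LinearIndependent ℝ A.col → LinearIndependent ℝ S.row →
        IsEconomyQR A QA RA →
        condNum (S * QA) < 49 → (n : ℝ) ^ 2 * u < 1 / 201 → (m : ℝ) / n + Real.sqrt n > 200 →
        condNum A < ENNReal.ofReal (1 / (3 * C₁ c u m s n * kS S QA)) →
        -- the computed sketch, triangular factor and preconditioned matrix
        ∀ (B : Matrix (Fin s) (Fin n) ℝ) (R : Matrix (Fin n) (Fin n) ℝ)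
          (Y : Matrix (Fin m) (Fin n) ℝ),
        FlMatMul u S A B → FlHouseholderQR u B R → FlRightTriSolve u R A Y →
        -- the iterate returned by LSQR and the computed solution
        ∀ (b δb : Fin m → ℝ) (ΔY : Matrix (Fin m) (Fin n) ℝ) (z x : Fin n → ℝ),
        z = pinv (Y + ΔY) *ᵥ (b + δb) → FlBackSub u R z x →
        ∃ ΔA : Matrix (Fin m) (Fin n) ℝ,
          IsLeastSquaresSolution (A + ΔA) (b + δb) x ∧
          ‖ΔA‖ < ‖S‖ * ‖A‖ * (6.04 * n * gam u n * ‖pinv (S * QA)‖ + 2.01 * ‖ΔY‖) :=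
  ⟨69, by norm_num, fun _ _ _ _ _ _ _ _ _ _ hu hm hs _ _ hQ hκSQ _ hmn hκA _ _ _ hB hR hY
      _ _ _ _ _ hz hx =>
    mainTheorem2_general hu hm hs hQ (linearIndependent_of_condNum_lt hκSQ) hmn hκA hB hR hY hz hx⟩
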